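/- **Theorem (Adequacy).** *Language.* Fix a countably infinite, totally ordered set of qubit variables. Statements are generated by $$S ::= \mathbf{skip}\mid \mathbf{new\ qbit}\ q\mid \mathbf{discard}\ q\mid q\mathrel{*}=U\mid S_0;S_1\mid \mathbf{meas}\ q\,(0\to S_0,1\to S_1)\mid \mathbf{while}\ q\ \mathbf{do}\ S\mid \mathbf{qcase}\ q\,(0\to S_0,1\to S_1),$$ with $U$ any one-qubit unitary, and $\mathrm{Var}(S)$ is the set of variables appearing in $S$. Environments $\Gamma,\Delta$ are finite sets of variables; $q,\Gamma$ denotes $\{q\}\cup\Gamma$ and presupposes $q\notin\Gamma$. A program $(\Gamma;S;\Delta)$ is well-formed if $\Gamma\vdash S\triangleright\Delta$ is derivable from the rules: $\Gamma\vdash\mathbf{skip}\triangleright\Gamma$; $\Gamma\vdash\mathbf{new\ qbit}\ q\triangleright q,\Gamma$; $q,\Gamma\vdash\mathbf{discard}\ q\triangleright\Gamma$; $q,\Gamma\vdash q\mathrel{*}=U\triangleright q,\Gamma$; if $\Gamma\vdash S_0\triangleright\Gamma'$ and $\Gamma'\vdash S_1\triangleright\Gamma''$ then $\Gamma\vdash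 S_0;S_1\triangleright\Gamma''$; if $q,\Gamma\vdash S_k\triangleright\Gamma'$ for $k=0,1$ then $q,\Gamma\vdash\mathbf{meas}\ q\,(0\to S_0,1\to S_1)\triangleright\Gamma'$; if $q,\Gamma\vdash S\triangleright q,\Gamma$ then $q,\Gamma\vdash\mathbf{while}\ q\ \mathbf{do}\ S\triangleright q,\Gamma$; if $\Gamma\vdash S_k\triangleright\Gamma'$ for $k=0,1$ and $q\notin\mathrm{Var}(S_0)\cup\mathrm{Var}(S_1)$ then $q,\Gamma\vdash\mathbf{qcase}\ q\,(0\to S_0,1\to S_1)\triangleright q,\Gamma'$. The output environment is determined by $\Gamma$ and $S$, and is denoted $\Gamma^S$. *States.* $\mathcal H_\Gamma=\mathbb C^{2^{|\Gamma|}}$ has one qubit for each variable of $\Gamma$. $St(\mathcal H_\Gamma)$ is the set of its vectors of norm at most $1$. One-qubit operators with subscript $q$ act on the qubit $q$, and tensor products with the identity are omitted. *Operational semantics.* Transitions $[S,|\psi\rangle]_\Gamma\to(|\psi'\rangle,\nu)$, with $\nu\in\{0,1\}$, are derived by the following rules. - $[\mathbf{skip},|\psi\rangle]\to(|\psi\rangle,1)$;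 $[\mathbf{new\ qbit}\ q,|\psi\rangle]\to(|0\rangle_q\otimes|\psi\rangle,1)$; $[q\mathrel{*}=U,|\psi\rangle]\to(U_q|\psi\rangle,1)$. - $[\mathbf{discard}\ q,|\psi\rangle]\to(\langle0|_q|\psi\rangle,1)$ and $[\mathbf{discard}\ q,|\psi\rangle]\to(\langle1|_q|\psi\rangle,0)$. - If $[S_0,|\psi\rangle]\to(|\psi'\rangle,\nu)$ and $[S_1,|\psi'\rangle]\to(|\psi''\rangle,\mu)$, then $[S_0;S_1,|\psi\rangle]\to(|\psi''\rangle,\nu\mu)$. - If $[S_0,|0\rangle\langle0|_q|\psi\rangle]\to(|\psi'\rangle,\nu)$, then $[\mathbf{meas}\ q\,(0\to S_0,1\to S_1),|\psi\rangle]\to(|\psi'\rangle,\nu)$. If $[S_1,|1\rangle\langle1|_q|\psi\rangle]\to(|\psi'\rangle,\nu)$, then $[\mathbf{meas}\ q\,(0\to S_0,1\to S_1),|\psi\rangle]\to(|\psi'\rangle,0)$. - $[\mathbf{while}\ q\ \mathbf{do}\ S,|\psi\rangle]\to(|0\rangle\langle0|_q|\psi\rangle,1)$. If $[S;\mathbf{while}\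 q\ \mathbf{do}\ S,|1\rangle\langle1|_q|\psi\rangle]\to(|\psi'\rangle,\nu)$, then $[\mathbf{while}\ q\ \mathbf{do}\ S,|\psi\rangle]\to(|\psi'\rangle,0)$. - If $[S_k,\langle k|_q|\psi\rangle]\to(|\psi_k\rangle,\nu_k)$ for $k=0,1$, then $[\mathbf{qcase}\ q\,(0\to S_0,1\to S_1),|\psi\rangle]\to(\nu_1|0\rangle_q\otimes|\psi_0\rangle+\nu_0|1\rangle_q\otimes|\psi_1\rangle,\ \nu_0\nu_1)$. The output ensemble $\mathscr E([S,|\psi\rangle]_\Gamma)$ is the multiset of the values $v\neq(0,0)$ with $[S,|\psi\rangle]_\Gamma\to v$, the multiplicity of $v$ being the number of distinct derivations of $[S,|\psi\rangle]_\Gamma\to v$. *Denotational semantics.* A quantum operation is a completely positive trace non-increasing linear map $\mathcal L(\mathcal H_A)\to\mathcal L(\mathcal H_B)$. Quantum operations are ordered by $\mathcal C\le\mathcal D$ iff $(\mathcal D\otimes\mathcal I_E)(\rho)-(\mathcal C\otimes\mathcal I_E)(\rho)$ is positive semidefinite for all finite-dimensional $\mathcal H_E$ and all density matrices $\rho$ (positive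 semidefinite, trace at most $1$) on $\mathcal H_A\otimes\mathcal H_E$. Let $\mathrm{Vac}$ be a one-dimensional space. For a linear map $\mathcal C$ from $\mathcal L(\mathcal H_A)$ to $\mathcal L(\mathcal H_B)$ and $F\in\mathcal L(\mathcal H_A,\mathcal H_B)$, let $$\tilde{\mathcal C}^F\begin{bmatrix}R&u\\v&w\end{bmatrix}=\begin{bmatrix}\mathcal C(R)&Fu\\vF^\dagger&w\end{bmatrix}$$ for operators on $\mathcal H_A\oplus\mathrm{Vac}$. Let $\mathcal K_{\Gamma;\Delta}$ be the set of pairs $(\mathcal C,F)$, with $\mathcal C:\mathcal L(\mathcal H_\Gamma)\to\mathcal L(\mathcal H_\Delta)$ and $F\in\mathcal L(\mathcal H_\Gamma,\mathcal H_\Delta)$, such that $\mathcal C$ and $\tilde{\mathcal C}^F$ are quantum operations, ordered by $(\mathcal C,F)\le(\mathcal D,G)$ iff $\tilde{\mathcal C}^F\le\tilde{\mathcal D}^G$. Put $\mathcal P^q_k=|k\rangle\langle k|_q(\cdot)|k\rangle\langle k|_q$ and $$(\mathcal D,G)\circ(\mathcal C,F)=(\mathcal D\circ\mathcal C,GF),\qquad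 \overline{\mathbf{meas}}_q[(\mathcal C_0,F_0),(\mathcal C_1,F_1)]=(\mathcal C_0\circ\mathcal P^q_0+\mathcal C_1\circ\mathcal P^q_1,\ F_0|0\rangle\langle0|_q),$$ $$\overline{\mathbf{qcase}}_q[(\mathcal C_0,F_0),(\mathcal C_1,F_1)]=\bigl(\mathcal P^q_0\otimes\mathcal C_0+\mathcal P^q_1\otimes\mathcal C_1+G_0(\cdot)G_1^\dagger+G_1(\cdot)G_0^\dagger,\ G_0+G_1\bigr),\quad G_k=|k\rangle\langle k|_q\otimes F_k.$$ The interpretation of well-formed programs is defined by $$[\![\mathbf{skip}]\!]_\Gamma=(\mathcal I_\Gamma,I_\Gamma),\quad [\![\mathbf{new\ qbit}\ q]\!]_\Gamma=(|0\rangle\langle0|_q\otimes\mathcal I_\Gamma,\ |0\rangle_q\otimes I_\Gamma),\quad [\![\mathbf{discard}\ q]\!]_{q,\Gamma}=(\mathrm{Tr}_q,\ \langle0|_q\otimes I_\Gamma),$$ $$[\![q\mathrel{*}=U]\!]_{q,\Gamma}=(U_q(\cdot)U_q^\dagger,\ U_q),\quad [\![S_0;S_1]\!]_\Gamma=[\![S_1]\!]_{\Gamma^{S_0}}\circ[\![S_0]\!]_\Gamma,\quad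 [\![\mathbf{meas}\ q\,(0\to S_0,1\to S_1)]\!]_{q,\Gamma}=\overline{\mathbf{meas}}_q\bigl[[\![S_0]\!]_{q,\Gamma},[\![S_1]\!]_{q,\Gamma}\bigr],$$ $$[\![\mathbf{qcase}\ q\,(0\to S_0,1\to S_1)]\!]_{q,\Gamma}=\overline{\mathbf{qcase}}_q\bigl[[\![S_0]\!]_\Gamma,[\![S_1]\!]_\Gamma\bigr],$$ and $[\![\mathbf{while}\ q\ \mathbf{do}\ S]\!]_{q,\Gamma}$ is the least fixed point in $\mathcal K_{q,\Gamma;q,\Gamma}$ of $(\mathcal C,F)\mapsto\overline{\mathbf{meas}}_q\bigl[(\mathcal I_{q,\Gamma},I_{q,\Gamma}),(\mathcal C,F)\circ[\![S]\!]_{q,\Gamma}\bigr]$. *Statement.* Let $(\Gamma;S;\Delta)$ be a well-formed program, $|\psi\rangle\in St(\mathcal H_\Gamma)$ and $[\![S]\!]_\Gamma=(\mathcal C,F)$. Then all multiplicities in $\mathscr E([S,|\psi\rangle]_\Gamma)$ are finite, and for every indexed family $\{(|\psi'_i\rangle,\nu_i)\}_i$ listing $\mathscr E([S,|\psi\rangle]_\Gamma)$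 with multiplicity, $$\mathcal C(|\psi\rangle\langle\psi|)=\sum_i|\psi'_i\rangle\langle\psi'_i|\qquad\text{and}\qquad F|\psi\rangle=\sum_i\nu_i|\psi'_i\rangle ,$$ where both families are (unconditionally) summable. -/

import Mathlib

open scoped Matrix BigOperators ComplexOrder

universe u

namespace QLang

/-! ### Syntax and well-formedness -/

/-- Statements over a set `X` of qubit variables; `U` ranges over all one-qubit unitary gates. -/
inductive Stmt (X : Type u) : Type u
  | skip : Stmt X
  | newQbit (q : X) : Stmt X
  | discard (q : X) : Stmt X
  | gate (q : X) (U : Matrix.unitaryGroup (Fin 2) ℂ) : Stmt X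
  | seq (S₀ S₁ : Stmt X) : Stmt X
  | meas (q : X) (S₀ S₁ : Stmt X) : Stmt X
  | whileDo (q : X) (S : Stmt X) : Stmt X
  | qcase (q : X) (S₀ S₁ : Stmt X) : Stmt X

/-- The variables appearing in a statement. -/
def Stmt.vars {X : Type u} : Stmt X → Set X
  | .skip => ∅
  | .newQbit q => {q}
  | .discard q => {q}
  | .gate q _ => {q}
  | .seq S₀ S₁ => S₀.vars ∪ S₁.vars
  | .meas q S₀ S₁ => {q} ∪ S₀.vars ∪ S₁.vars
  | .whileDo q S => {q} ∪ S.vars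
  | .qcase q S₀ S₁ => {q} ∪ S₀.vars ∪ S₁.vars

variable {X : Type u} [DecidableEq X]

/-- `Ext q Γ Γ₁` says that `Γ₁` is the environment `q, Γ`, which presupposes `q ∉ Γ`. -/
structure Ext (q : X) (Γ Γ₁ : Finset X) : Prop where
  notMem : q ∉ Γ
  eq_insert : Γ₁ = insert q Γ

theorem Ext.mem {q : X} {Γ Γ₁ : Finset X} (h : Ext q Γ Γ₁) : q ∈ Γ₁ := by
  rw [h.eq_insert]; exact Finset.mem_insert_self q Γ

theorem Ext.subset {q : X} {Γ Γ₁ : Finset X} (h : Ext q Γ Γ₁) : Γ ⊆ Γ₁ := by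
  rw [h.eq_insert]; exact Finset.subset_insert q Γ

/-- Derivations of the judgment `Γ ⊢ S ▷ Δ`. The program `(Γ; S; Δ)` is well-formed when this type
is inhabited; it never has more than one element (`Typing.subsingleton`), so that defining a
semantics by recursion on it amounts to defining it on well-formed programs. -/
inductive Typing : Finset X → Stmt X → Finset X → Type u
  | skip {Γ : Finset X} : Typing Γ .skip Γ
  | newQbit {Γ Δ : Finset X} {q : X} (h : Ext q Γ Δ) : Typing Γ (.newQbit q) Δ
  | discard {Γ Δ : Finset X} {q : X} (h : Ext q Δ Γ) : Typing Γ (.discard q) Δ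
  | gate {Γ : Finset X} {q : X} {U : Matrix.unitaryGroup (Fin 2) ℂ} (h : q ∈ Γ) :
      Typing Γ (.gate q U) Γ
  | seq {Γ Γ' Γ'' : Finset X} {S₀ S₁ : Stmt X}
      (t₀ : Typing Γ S₀ Γ') (t₁ : Typing Γ' S₁ Γ'') : Typing Γ (.seq S₀ S₁) Γ''
  | meas {Γ Γ' : Finset X} {q : X} {S₀ S₁ : Stmt X} (h : q ∈ Γ)
      (t₀ : Typing Γ S₀ Γ') (t₁ : Typing Γ S₁ Γ') : Typing Γ (.meas q S₀ S₁) Γ'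
  | whileDo {Γ : Finset X} {q : X} {S : Stmt X} (h : q ∈ Γ)
      (t : Typing Γ S Γ) : Typing Γ (.whileDo q S) Γ
  | qcase {Γ Γ₁ Δ Δ₁ : Finset X} {q : X} {S₀ S₁ : Stmt X} (hΓ : Ext q Γ Γ₁) (hΔ : Ext q Δ Δ₁)
      (t₀ : Typing Γ S₀ Δ) (t₁ : Typing Γ S₁ Δ) (hq : q ∉ S₀.vars ∪ S₁.vars) :
      Typing Γ₁ (.qcase q S₀ S₁) Δ₁

theorem Ext.unique_left {q : X} {Γ Γ' Γ₁ : Finset X} (h : Ext q Γ Γ₁) (h' : Ext q Γ' Γ₁) :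
    Γ = Γ' := by
  rw [← Finset.erase_insert h.notMem, ← Finset.erase_insert h'.notMem, ← h.eq_insert,
    ← h'.eq_insert]

theorem Typing.output_unique {Γ Δ Δ' : Finset X} {S : Stmt X} (t : Typing Γ S Δ)
    (t' : Typing Γ S Δ') : Δ = Δ' := by
  induction t generalizing Δ' with
  | skip => cases t'; rfl
  | newQbit h => cases t' with | newQbit h' => rw [h.eq_insert, h'.eq_insert]
  | discard h => cases t' with | discard h' => exact h.unique_left h'
  | gate h => cases t'; rfl
  | seq t₀ t₁ ih₀ ih₁ =>
    cases t' with
    | seq s₀ s₁ => obtain rfl := ih₀ s₀; exact ih₁ s₁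
  | meas h t₀ t₁ ih₀ ih₁ => cases t' with | meas h' s₀ s₁ => exact ih₀ s₀
  | whileDo h t ih => cases t'; rfl
  | qcase hΓ hΔ t₀ t₁ hq ih₀ ih₁ =>
    cases t' with
    | qcase hΓ' hΔ' s₀ s₁ hq' =>
      obtain rfl := hΓ.unique_left hΓ'
      obtain rfl := ih₀ s₀
      rw [hΔ.eq_insert, hΔ'.eq_insert]

theorem Typing.subsingleton {Γ Δ : Finset X} {S : Stmt X} (t t' : Typing Γ S Δ) : t = t' := by
  induction t with
  | skip => cases t'; rfl
  | newQbit h => cases t'; rfl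
  | discard h => cases t'; rfl
  | gate h => cases t'; rfl
  | seq t₀ t₁ ih₀ ih₁ =>
    cases t' with
    | seq s₀ s₁ =>
      obtain rfl := t₀.output_unique s₀
      rw [ih₀ s₀, ih₁ s₁]
  | meas h t₀ t₁ ih₀ ih₁ => cases t' with | meas h' s₀ s₁ => rw [ih₀ s₀, ih₁ s₁]
  | whileDo h t ih => cases t' with | whileDo h' s => rw [ih s]
  | qcase hΓ hΔ t₀ t₁ hq ih₀ ih₁ =>
    cases t' with
    | qcase hΓ' hΔ' s₀ s₁ hq' =>
      obtain rfl := hΓ.unique_left hΓ'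
      obtain rfl := hΔ.unique_left hΔ'
      rw [ih₀ s₀, ih₁ s₁]

/-! ### State spaces and one-qubit operators -/

/-- Computational basis states of the qubits of `Γ`: a bit for each variable of `Γ`. -/
abbrev Basis (Γ : Finset X) : Type u := {p : X // p ∈ Γ} → Fin 2

/-- The state space of the qubits of `Γ`, of dimension `2 ^ |Γ|`, in its computational basis. As the
basis is labelled by variable names, no order of the tensor factors has to be chosen. -/
abbrev Hilb (Γ : Finset X) : Type u := Basis Γ → ℂ

/-- Linear maps from the state space of `Γ` to that of `Δ`. -/
abbrev Op (Γ Δ : Finset X) : Type u := Matrix (Basis Δ) (Basis Γ) ℂ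

/-- The (subnormalized) states: vectors of Euclidean norm at most one. -/
def St (Γ : Finset X) : Set (Hilb Γ) := {ψ | ∑ x, ‖ψ x‖ ^ 2 ≤ 1}

/-- The operator `|ψ⟩⟨ψ|`. -/
def ketbra {A : Type*} (ψ : A → ℂ) : Matrix A A ℂ := Matrix.vecMulVec ψ (star ψ)

/-- The operator `|b⟩_q ⊗ I_Γ`, from the space of `Γ` to that of `q, Γ`. -/
def ket {q : X} {Γ Γ₁ : Finset X} (h : Ext q Γ Γ₁) (b : Fin 2) : Op Γ Γ₁ := fun y x =>
  if y ⟨q, h.mem⟩ = b ∧ ∀ p : {p : X // p ∈ Γ}, y ⟨p.1, h.subset p.2⟩ = x p then 1 else 0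

/-- The operator `⟨b|_q ⊗ I_Γ`, from the space of `q, Γ` to that of `Γ`. -/
def bra {q : X} {Γ Γ₁ : Finset X} (h : Ext q Γ Γ₁) (b : Fin 2) : Op Γ₁ Γ := (ket h b)ᴴ

/-- The projector `|b⟩⟨b|_q`, tensored with the identity on the other qubits of `Γ`. -/
def proj {q : X} {Γ : Finset X} (h : q ∈ Γ) (b : Fin 2) : Op Γ Γ :=
  Matrix.diagonal fun x => if x ⟨q, h⟩ = b then 1 else 0

/-- The gate `U` on the qubit `q`, tensored with the identity on the other qubits of `Γ`. -/
def gateOp {q : X} {Γ : Finset X} (h : q ∈ Γ) (U : Matrix (Fin 2) (Fin 2) ℂ) : Op Γ Γ :=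
  fun y x => if ∀ p : {p : X // p ∈ Γ}, p.1 ≠ q → y p = x p then U (y ⟨q, h⟩) (x ⟨q, h⟩) else 0

/-! ### Operational semantics -/

/-- The bit `ν` as a complex number, `0` or `1`. -/
def bit (ν : Bool) : ℂ := if ν then 1 else 0

/-- Derivations of the big-step transition `[S, ψ]_Γ → (φ, ν)`, for a well-formed program
`(Γ; S; Δ)`. It is valued in `Type` because derivations are counted below. -/
inductive Exec : {Γ Δ : Finset X} → {S : Stmt X} → Typing Γ S Δ → Hilb Γ → Hilb Δ → Bool → Type u
  | skip {Γ : Finset X} (ψ : Hilb Γ) : Exec Typing.skip ψ ψ true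
  | newQbit {Γ Δ : Finset X} {q : X} (h : Ext q Γ Δ) (ψ : Hilb Γ) :
      Exec (Typing.newQbit h) ψ (ket h 0 *ᵥ ψ) true
  | discard₀ {Γ Δ : Finset X} {q : X} (h : Ext q Δ Γ) (ψ : Hilb Γ) :
      Exec (Typing.discard h) ψ (bra h 0 *ᵥ ψ) true
  | discard₁ {Γ Δ : Finset X} {q : X} (h : Ext q Δ Γ) (ψ : Hilb Γ) :
      Exec (Typing.discard h) ψ (bra h 1 *ᵥ ψ) false
  | gate {Γ : Finset X} {q : X} {U : Matrix.unitaryGroup (Fin 2) ℂ} (h : q ∈ Γ) (ψ : Hilb Γ) :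
      Exec (Typing.gate (U := U) h) ψ (gateOp h U.1 *ᵥ ψ) true
  | seq {Γ Γ' Γ'' : Finset X} {S₀ S₁ : Stmt X} {t₀ : Typing Γ S₀ Γ'} {t₁ : Typing Γ' S₁ Γ''}
      {ψ : Hilb Γ} {φ : Hilb Γ'} {χ : Hilb Γ''} {ν μ : Bool}
      (d₀ : Exec t₀ ψ φ ν) (d₁ : Exec t₁ φ χ μ) : Exec (Typing.seq t₀ t₁) ψ χ (ν && μ)
  | meas₀ {Γ Γ' : Finset X} {q : X} {S₀ S₁ : Stmt X} (h : q ∈ Γ) {t₀ : Typing Γ S₀ Γ'}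
      {t₁ : Typing Γ S₁ Γ'} {ψ : Hilb Γ} {φ : Hilb Γ'} {ν : Bool}
      (d : Exec t₀ (proj h 0 *ᵥ ψ) φ ν) : Exec (Typing.meas h t₀ t₁) ψ φ ν
  | meas₁ {Γ Γ' : Finset X} {q : X} {S₀ S₁ : Stmt X} (h : q ∈ Γ) {t₀ : Typing Γ S₀ Γ'}
      {t₁ : Typing Γ S₁ Γ'} {ψ : Hilb Γ} {φ : Hilb Γ'} {ν : Bool}
      (d : Exec t₁ (proj h 1 *ᵥ ψ) φ ν) : Exec (Typing.meas h t₀ t₁) ψ φ false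
  | while₀ {Γ : Finset X} {q : X} {S : Stmt X} (h : q ∈ Γ) {t : Typing Γ S Γ} (ψ : Hilb Γ) :
      Exec (Typing.whileDo h t) ψ (proj h 0 *ᵥ ψ) true
  | while₁ {Γ : Finset X} {q : X} {S : Stmt X} (h : q ∈ Γ) {t : Typing Γ S Γ} {ψ φ : Hilb Γ}
      {ν : Bool} (d : Exec (Typing.seq t (Typing.whileDo h t)) (proj h 1 *ᵥ ψ) φ ν) :
      Exec (Typing.whileDo h t) ψ φ false
  | qcase {Γ Γ₁ Δ Δ₁ : Finset X} {q : X} {S₀ S₁ : Stmt X} (hΓ : Ext q Γ Γ₁) (hΔ : Ext q Δ Δ₁)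
      {t₀ : Typing Γ S₀ Δ} {t₁ : Typing Γ S₁ Δ} (hq : q ∉ S₀.vars ∪ S₁.vars) {ψ : Hilb Γ₁}
      {φ₀ φ₁ : Hilb Δ} {ν₀ ν₁ : Bool}
      (d₀ : Exec t₀ (bra hΓ 0 *ᵥ ψ) φ₀ ν₀) (d₁ : Exec t₁ (bra hΓ 1 *ᵥ ψ) φ₁ ν₁) :
      Exec (Typing.qcase hΓ hΔ t₀ t₁ hq) ψ
        (bit ν₁ • (ket hΔ 0 *ᵥ φ₀) + bit ν₀ • (ket hΔ 1 *ᵥ φ₁)) (ν₀ && ν₁)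

/-- The output ensemble of the configuration `[S, ψ]_Γ`, as the function giving the multiplicity of
each value: the number of derivations of that value, except that the value `(0, 0)` is removed. -/
noncomputable def outputEnsemble {Γ Δ : Finset X} {S : Stmt X} (t : Typing Γ S Δ) (ψ : Hilb Γ)
    (v : Hilb Δ × Bool) : ℕ∞ :=
  open Classical in if v = (0, false) then 0 else ENat.card (Exec t ψ v.1 v.2)

/-- The family `f` lists the elements of the multiset with multiplicities `M`. -/
def Enumerates {ι V : Type*} (f : ι → V) (M : V → ℕ∞) : Prop :=
  ∀ v, ENat.card {i // f i = v} = M v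

/-! ### Quantum operations -/

/-- Linear maps between algebras of operators. -/
abbrev SuperOp (A B : Type*) : Type _ := Matrix A A ℂ →ₗ[ℂ] Matrix B B ℂ

/-- The map `𝒞 ⊗ ℐ_E`, applied blockwise. -/
def ampliation {A B : Type*} (C : SuperOp A B) (E : Type*)
    (ρ : Matrix (A × E) (A × E) ℂ) : Matrix (B × E) (B × E) ℂ :=
  fun y z => C (fun a a' => ρ (a, y.2) (a', z.2)) y.1 z.1

/-- Completely positive trace non-increasing maps. -/
structure IsQuantumOp {A B : Type*} [Fintype A] [Fintype B] (C : SuperOp A B) : Prop where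
  completelyPositive : ∀ (n : ℕ) (ρ : Matrix (A × Fin n) (A × Fin n) ℂ),
    ρ.PosSemidef → (ampliation C (Fin n) ρ).PosSemidef
  trace_le : ∀ ρ : Matrix A A ℂ, ρ.PosSemidef → (C ρ).trace.re ≤ ρ.trace.re

/-- Density matrices: positive semidefinite of trace at most one. -/
def IsDensity {A : Type*} [Fintype A] (ρ : Matrix A A ℂ) : Prop :=
  ρ.PosSemidef ∧ ρ.trace.re ≤ 1

/-- The Löwner order on quantum operations. -/
def LoewnerLE {A B : Type*} [Fintype A] [Fintype B] (C D : SuperOp A B) : Prop :=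
  ∀ (n : ℕ) (ρ : Matrix (A × Fin n) (A × Fin n) ℂ), IsDensity ρ →
    (ampliation D (Fin n) ρ - ampliation C (Fin n) ρ).PosSemidef

/-- The map `ρ ↦ M ρ N`. -/
def sandwich {A B : Type*} [Fintype A] (M : Matrix B A ℂ) (N : Matrix A B ℂ) :
    SuperOp A B where
  toFun ρ := M * ρ * N
  map_add' ρ σ := by rw [Matrix.mul_add, Matrix.add_mul]
  map_smul' c ρ := by simp

/-- The map `ρ ↦ M ρ M†`. -/
def conjBy {A B : Type*} [Fintype A] (M : Matrix B A ℂ) : SuperOp A B := sandwich M Mᴴ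

/-- The extension of `(𝒞, F)` to operators on `ℋ_A ⊕ Vac`, as a block matrix
`[[R, u], [v, w]] ↦ [[𝒞 R, F u], [v F†, w]]`, which is
`𝒞(P ρ P) + F ρ |vac⟩⟨vac| + |vac⟩⟨vac| ρ F† + |vac⟩⟨vac| ρ |vac⟩⟨vac|`. -/
def vacuumExt {A B : Type*} [Fintype A] (C : SuperOp A B) (F : Matrix B A ℂ) :
    SuperOp (A ⊕ Unit) (B ⊕ Unit) where
  toFun ρ := Matrix.fromBlocks (C ρ.toBlocks₁₁) (F * ρ.toBlocks₁₂) (ρ.toBlocks₂₁ * Fᴴ) ρ.toBlocks₂₂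
  map_add' ρ σ := by
    have h₁ : (ρ + σ).toBlocks₁₁ = ρ.toBlocks₁₁ + σ.toBlocks₁₁ := rfl
    have h₂ : (ρ + σ).toBlocks₁₂ = ρ.toBlocks₁₂ + σ.toBlocks₁₂ := rfl
    have h₃ : (ρ + σ).toBlocks₂₁ = ρ.toBlocks₂₁ + σ.toBlocks₂₁ := rfl
    have h₄ : (ρ + σ).toBlocks₂₂ = ρ.toBlocks₂₂ + σ.toBlocks₂₂ := rfl
    rw [h₁, h₂, h₃, h₄, Matrix.fromBlocks_add, map_add, Matrix.mul_add, Matrix.add_mul]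
  map_smul' c ρ := by
    have h₁ : (c • ρ).toBlocks₁₁ = c • ρ.toBlocks₁₁ := rfl
    have h₂ : (c • ρ).toBlocks₁₂ = c • ρ.toBlocks₁₂ := rfl
    have h₃ : (c • ρ).toBlocks₂₁ = c • ρ.toBlocks₂₁ := rfl
    have h₄ : (c • ρ).toBlocks₂₂ = c • ρ.toBlocks₂₂ := rfl
    rw [h₁, h₂, h₃, h₄, RingHom.id_apply, Matrix.fromBlocks_smul, map_smul, Matrix.mul_smul,
      Matrix.smul_mul]

/-! ### Denotational semantics -/

/-- Pairs `(𝒞, F)` of a map on operators and a transformation matrix. -/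
abbrev Den (Γ Δ : Finset X) : Type u := SuperOp (Basis Γ) (Basis Δ) × Op Γ Δ

/-- The pairs `(𝒞, F)` such that `𝒞` and its extension given by `F` are quantum operations. -/
def vacuumPairs (Γ Δ : Finset X) : Set (Den Γ Δ) :=
  {p | IsQuantumOp p.1 ∧ IsQuantumOp (vacuumExt p.1 p.2)}

/-- The order on such pairs: the Löwner order of the vacuum extensions. -/
def Den.LE {Γ Δ : Finset X} (p r : Den Γ Δ) : Prop :=
  LoewnerLE (vacuumExt p.1 p.2) (vacuumExt r.1 r.2)

/-- Composition, `p` after `r`. -/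
def Den.comp {Γ Γ' Γ'' : Finset X} (p : Den Γ' Γ'') (r : Den Γ Γ') : Den Γ Γ'' :=
  (p.1 ∘ₗ r.1, p.2 * r.2)

def Den.id (Γ : Finset X) : Den Γ Γ := (LinearMap.id, 1)

def Den.meas {q : X} {Γ Γ' : Finset X} (h : q ∈ Γ) (p₀ p₁ : Den Γ Γ') : Den Γ Γ' :=
  (p₀.1 ∘ₗ conjBy (proj h 0) + p₁.1 ∘ₗ conjBy (proj h 1), p₀.2 * proj h 0)

/-- Here `ket hΔ b * F * bra hΓ b` is the operator `|b⟩⟨b|_q ⊗ F`, and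
`conjBy (ket hΔ b) ∘ₗ 𝒞 ∘ₗ conjBy (bra hΓ b)` is the map `|b⟩⟨b|_q (·) |b⟩⟨b|_q ⊗ 𝒞`. -/
def Den.qcase {q : X} {Γ Γ₁ Δ Δ₁ : Finset X} (hΓ : Ext q Γ Γ₁) (hΔ : Ext q Δ Δ₁)
    (p₀ p₁ : Den Γ Δ) : Den Γ₁ Δ₁ :=
  (conjBy (ket hΔ 0) ∘ₗ p₀.1 ∘ₗ conjBy (bra hΓ 0)
      + conjBy (ket hΔ 1) ∘ₗ p₁.1 ∘ₗ conjBy (bra hΓ 1)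
      + sandwich (ket hΔ 0 * p₀.2 * bra hΓ 0) (ket hΔ 1 * p₁.2 * bra hΓ 1)ᴴ
      + sandwich (ket hΔ 1 * p₁.2 * bra hΓ 1) (ket hΔ 0 * p₀.2 * bra hΓ 0)ᴴ,
    ket hΔ 0 * p₀.2 * bra hΓ 0 + ket hΔ 1 * p₁.2 * bra hΓ 1)

/-- `p` is a least fixed point of `Φ` among the pairs in `vacuumPairs Γ Γ`. -/
def IsLfp {Γ : Finset X} (Φ : Den Γ Γ → Den Γ Γ) (p : Den Γ Γ) : Prop :=
  p ∈ vacuumPairs Γ Γ ∧ Φ p = p ∧ ∀ r ∈ vacuumPairs Γ Γ, Φ r = r → p.LE r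

/-- The least fixed point of `Φ` (and the pair `(0, 0)` if there is none). -/
noncomputable def lfp {Γ : Finset X} (Φ : Den Γ Γ → Den Γ Γ) : Den Γ Γ :=
  open Classical in if h : ∃ p, IsLfp Φ p then h.choose else 0

/-- The denotation of the well-formed program `(Γ; S; Δ)`. -/
noncomputable def den : {Γ Δ : Finset X} → {S : Stmt X} → Typing Γ S Δ → Den Γ Δ
  | Γ, _, _, .skip => Den.id Γ
  | _, _, _, .newQbit h => (conjBy (ket h 0), ket h 0)
  | _, _, _, .discard h => (conjBy (bra h 0) + conjBy (bra h 1), bra h 0)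
  | _, _, _, .gate (U := U) h => (conjBy (gateOp h U.1), gateOp h U.1)
  | _, _, _, .seq t₀ t₁ => (den t₁).comp (den t₀)
  | _, _, _, .meas h t₀ t₁ => Den.meas h (den t₀) (den t₁)
  | Γ, _, _, .whileDo h t => lfp fun p => Den.meas h (Den.id Γ) (p.comp (den t))
  | _, _, _, .qcase hΓ hΔ t₀ t₁ _ => Den.qcase hΓ hΔ (den t₀) (den t₁)

end QLang

/-!
Everything is a structural induction on the program. For adequacy one proves, for all input vectors
at once, that `𝒞(|ψ⟩⟨ψ|)` is the sum of `|φ⟩⟨φ|` over all derivations, and that exactly one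
derivation, the coherent one, has bit `1`, its value being `F|ψ⟩`. The weighted sum of the vectors
then collapses to one term, and in the quantum case the cross terms come only from the pair of the
two coherent derivations.

For a loop with body `(ℬ, _)`, put `ℰ = 𝒫₀` and `𝒯 = ℬ ∘ 𝒫₁`, where `𝒫ₖ = |k⟩⟨k| (·) |k⟩⟨k|`. As
`ℰ` and `𝒯` together do not increase the trace, `∑ₙ ℰ ∘ 𝒯ⁿ` converges, and its sum is the least
solution of `ℰ + 𝒟 ∘ 𝒯 = 𝒟`. The `n`-th term is the sum over the derivations that run the body `n`
times.

That the extensions by the vacuum are quantum operations follows from the complete positivity of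
`ρ ↦ 𝒞 ρ - F ρ F†`. Infinite sums of positive semidefinite matrices are controlled by their traces,
which bound all their entries.
-/

namespace QLang

/-! ### Sums of positive semidefinite matrices -/

section PosSemidef

variable {A ι : Type*}

theorem isClosed_setOf_posSemidef [Finite A] : IsClosed {ρ : Matrix A A ℂ | ρ.PosSemidef} := by
  cases nonempty_fintype A
  simp only [Matrix.posSemidef_iff_dotProduct_mulVec, Set.ofPred_and, Set.ofPred_forall]
  refine .inter (isClosed_eq (by fun_prop) continuous_id) (isClosed_iInter fun x => ?_)
  exact isClosed_le continuous_const (by fun_prop)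

open scoped Matrix.Norms.L2Operator MatrixOrder in
theorem span_setOf_posSemidef [Finite A] :
    Submodule.span ℂ {ρ : Matrix A A ℂ | ρ.PosSemidef} = ⊤ := by
  classical
  cases nonempty_fintype A
  simpa only [Matrix.nonneg_iff_posSemidef] using CStarAlgebra.span_nonneg (A := Matrix A A ℂ)

theorem superOp_ext_of_posSemidef [Finite A] {B : Type*} {C C' : SuperOp A B}
    (h : ∀ ρ, ρ.PosSemidef → C ρ = C' ρ) : C = C' :=
  LinearMap.ext_on span_setOf_posSemidef fun ρ hρ => h ρ hρ

theorem ketbra_add (φ χ : A → ℂ) : ketbra (φ + χ) = ketbra φ + ketbra χ +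
    (Matrix.vecMulVec φ (star χ) + Matrix.vecMulVec χ (star φ)) := by
  simp only [ketbra, star_add, Matrix.add_vecMulVec, Matrix.vecMulVec_add]
  abel

@[simp]
theorem ketbra_eq_zero {ψ : A → ℂ} : ketbra ψ = 0 ↔ ψ = 0 := by
  rw [ketbra, Matrix.vecMulVec_eq_zero, star_eq_zero, or_self]

theorem posSemidef_ketbra [Finite A] (ψ : A → ℂ) : (ketbra ψ).PosSemidef :=
  Matrix.posSemidef_vecMulVec_self_star ψ

theorem eq_zero_of_posSemidef_of_posSemidef_neg [Finite A] {ρ : Matrix A A ℂ}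
    (h : ρ.PosSemidef) (h' : (-ρ).PosSemidef) : ρ = 0 := by
  cases nonempty_fintype A
  refine h.trace_eq_zero_iff.1 (le_antisymm ?_ h.trace_nonneg)
  simpa only [Matrix.trace_neg, Left.nonneg_neg_iff] using h'.trace_nonneg

section Trace

variable [Fintype A]

theorem trace_re_ketbra (ψ : A → ℂ) : (ketbra ψ).trace.re = ∑ a, ‖ψ a‖ ^ 2 := by
  simp only [ketbra, Matrix.trace, Matrix.diag_apply, Matrix.vecMulVec_apply, Pi.star_apply,
    Complex.star_def, Complex.mul_conj', Complex.re_sum, ← Complex.ofReal_pow, Complex.ofReal_re]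

theorem norm_ketbra_apply_le_trace_re (ψ : A → ℂ) (a b : A) :
    ‖ketbra ψ a b‖ ≤ (ketbra ψ).trace.re := by
  have hle (c : A) : ‖ψ c‖ ^ 2 ≤ ∑ c, ‖ψ c‖ ^ 2 :=
    Finset.single_le_sum (f := fun c => ‖ψ c‖ ^ 2) (fun _ _ => sq_nonneg _) (Finset.mem_univ c)
  rw [trace_re_ketbra, ketbra, Matrix.vecMulVec_apply, norm_mul, Pi.star_apply, norm_star]
  linarith [two_mul_le_add_sq ‖ψ a‖ ‖ψ b‖, hle a, hle b]

theorem norm_apply_le_trace_re {ρ : Matrix A A ℂ} (hρ : ρ.PosSemidef) (a b : A) :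
    ‖ρ a b‖ ≤ ρ.trace.re := by
  obtain ⟨m, v, rfl⟩ := Matrix.posSemidef_iff_eq_sum_vecMulVec.1 hρ
  rw [Matrix.sum_apply, Matrix.trace_sum, Complex.re_sum]
  exact norm_sum_le_of_le _ fun i _ => norm_ketbra_apply_le_trace_re (v i) a b

theorem trace_re_nonneg {ρ : Matrix A A ℂ} (hρ : ρ.PosSemidef) : 0 ≤ ρ.trace.re :=
  (Complex.nonneg_iff.1 hρ.trace_nonneg).1

theorem summable_of_posSemidef {f : ι → Matrix A A ℂ} (hf : ∀ i, (f i).PosSemidef)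
    (h : Summable fun i => (f i).trace.re) : Summable f :=
  Pi.summable.2 fun a => Pi.summable.2 fun b =>
    .of_norm_bounded h fun i => norm_apply_le_trace_re (hf i) a b

theorem hasSum_trace_re {f : ι → Matrix A A ℂ} {ρ : Matrix A A ℂ} (h : HasSum f ρ) :
    HasSum (fun i => (f i).trace.re) ρ.trace.re :=
  h.map (Complex.reAddGroupHom.comp (Matrix.traceAddMonoidHom A ℂ))
    (Complex.continuous_re.comp continuous_id.matrix_trace)

end Trace

theorem hasSum_sigma_of_posSemidef [Finite A] {κ : ι → Type*} {f : (Σ i, κ i) → Matrix A A ℂ}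
    {g : ι → Matrix A A ℂ} {ρ : Matrix A A ℂ} (hf : ∀ p, (f p).PosSemidef)
    (h : ∀ i, HasSum (fun k => f ⟨i, k⟩) (g i)) (hg : HasSum g ρ) : HasSum f ρ := by
  cases nonempty_fintype A
  refine hg.sigma_of_hasSum h (summable_of_posSemidef hf ?_)
  refine (summable_sigma_of_nonneg fun p => trace_re_nonneg (hf p)).2
    ⟨fun i => (hasSum_trace_re (h i)).summable, ?_⟩
  exact (hasSum_trace_re hg).summable.congr fun i => (hasSum_trace_re (h i)).tsum_eq.symm

end PosSemidef

/-! ### Completely positive maps -/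

section CompletelyPositive

variable {A B D : Type*}

/-- Complete positivity, without the bound on the trace that `IsQuantumOp` adds to it. -/
def IsCP (C : SuperOp A B) : Prop :=
  ∀ (n : ℕ) (ρ : Matrix (A × Fin n) (A × Fin n) ℂ),
    ρ.PosSemidef → (ampliation C (Fin n) ρ).PosSemidef

theorem ampliation_smul (C : SuperOp A B) (E : Type*) (c : ℂ) (ρ : Matrix (A × E) (A × E) ℂ) :
    ampliation C E (c • ρ) = c • ampliation C E ρ := by
  ext y z
  exact congrFun (congrFun (C.map_smul c _) y.1) z.1

namespace IsCP

theorem map_posSemidef {C : SuperOp A B} (hC : IsCP C) {ρ : Matrix A A ℂ} (hρ : ρ.PosSemidef) :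
    (C ρ).PosSemidef :=
  (hC 1 _ (hρ.submatrix Prod.fst)).submatrix fun b => (b, 0)

theorem zero : IsCP (0 : SuperOp A B) := fun _ _ _ => .zero

theorem add {C C' : SuperOp A B} (hC : IsCP C) (hC' : IsCP C') : IsCP (C + C') :=
  fun n ρ hρ => (hC n ρ hρ).add (hC' n ρ hρ)

theorem sum {ι : Type*} {C : ι → SuperOp A B} (hC : ∀ i, IsCP (C i)) (s : Finset ι) :
    IsCP (∑ i ∈ s, C i) :=
  Finset.sum_induction C IsCP (fun _ _ => add) zero fun i _ => hC i

theorem id : IsCP (LinearMap.id : SuperOp A A) := fun _ _ hρ => hρ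

theorem comp {C' : SuperOp B D} {C : SuperOp A B} (hC' : IsCP C') (hC : IsCP C) :
    IsCP (C' ∘ₗ C) :=
  fun n ρ hρ => hC' n _ (hC n ρ hρ)

theorem pow {T : Module.End ℂ (Matrix A A ℂ)} (hT : IsCP T) : ∀ n : ℕ, IsCP (T ^ n)
  | 0 => id
  | n + 1 => (pow_succ T n).symm ▸ (hT.pow n).comp hT

theorem of_tendsto [Finite B] {C : ℕ → SuperOp A B} {C' : SuperOp A B} (hC : ∀ n, IsCP (C n))
    (h : ∀ ρ, Filter.Tendsto (C · ρ) Filter.atTop (nhds (C' ρ))) : IsCP C' := by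
  intro m ρ hρ
  suffices hlim : Filter.Tendsto (fun n => ampliation (C n) (Fin m) ρ) Filter.atTop
      (nhds (ampliation C' (Fin m) ρ)) from
    isClosed_setOf_posSemidef.mem_of_tendsto hlim (.of_forall fun n => hC n m ρ hρ)
  exact tendsto_pi_nhds.2 fun y => tendsto_pi_nhds.2 fun z =>
    tendsto_pi_nhds.1 (tendsto_pi_nhds.1 (h _) _) _

theorem eq_zero_of_neg [Finite A] [Finite B] {C : SuperOp A B} (h : IsCP C) (h' : IsCP (-C)) :
    C = 0 := by
  cases nonempty_fintype B
  exact superOp_ext_of_posSemidef fun ρ hρ =>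
    eq_zero_of_posSemidef_of_posSemidef_neg (h.map_posSemidef hρ) (h'.map_posSemidef hρ)

end IsCP

theorem IsQuantumOp.isCP [Fintype A] [Fintype B] {C : SuperOp A B} (hC : IsQuantumOp C) : IsCP C :=
  hC.completelyPositive

theorem loewnerLE_iff_isCP_sub [Fintype A] [Fintype B] {C C' : SuperOp A B} :
    LoewnerLE C C' ↔ IsCP (C' - C) := by
  refine ⟨fun h n ρ hρ => ?_, fun h n ρ hρ => h n ρ hρ.1⟩
  have htr : 0 < 1 + ρ.trace.re := by linarith [trace_re_nonneg hρ]
  have hc : (0 : ℂ) < ((1 + ρ.trace.re)⁻¹ : ℝ) := by exact_mod_cast inv_pos.2 htr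
  have hdens : IsDensity ((((1 + ρ.trace.re)⁻¹ : ℝ) : ℂ) • ρ) := by
    refine ⟨hρ.smul hc.le, ?_⟩
    rw [Matrix.trace_smul, smul_eq_mul, Complex.re_ofReal_mul, inv_mul_le_one₀ htr]
    linarith
  have hpos := (h n _ hdens).smul (inv_pos.2 hc).le
  rwa [ampliation_smul, ampliation_smul, ← smul_sub, inv_smul_smul₀ hc.ne'] at hpos

theorem LoewnerLE.antisymm [Fintype A] [Fintype B] {C C' : SuperOp A B} (h : LoewnerLE C C')
    (h' : LoewnerLE C' C) : C = C' := by
  rw [loewnerLE_iff_isCP_sub] at h h'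
  exact (sub_eq_zero.1 (h.eq_zero_of_neg (by rwa [neg_sub]))).symm

section Conjugation

variable [Fintype A]

theorem sandwich_apply (M : Matrix B A ℂ) (N : Matrix A B ℂ) (ρ : Matrix A A ℂ) :
    sandwich M N ρ = M * ρ * N := rfl

theorem conjBy_apply (M : Matrix B A ℂ) (ρ : Matrix A A ℂ) : conjBy M ρ = M * ρ * Mᴴ := rfl

theorem conjBy_one [DecidableEq A] : conjBy (1 : Matrix A A ℂ) = LinearMap.id := by
  ext1 ρ
  rw [conjBy_apply, Matrix.conjTranspose_one, Matrix.one_mul, Matrix.mul_one, LinearMap.id_apply]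

theorem conjBy_comp [Fintype B] (M : Matrix D B ℂ) (N : Matrix B A ℂ) :
    conjBy M ∘ₗ conjBy N = conjBy (M * N) := by
  ext1 ρ
  simp only [LinearMap.comp_apply, conjBy_apply, Matrix.conjTranspose_mul, Matrix.mul_assoc]

theorem conjBy_add (M N : Matrix B A ℂ) :
    conjBy (M + N) = conjBy M + conjBy N + sandwich M Nᴴ + sandwich N Mᴴ := by
  ext1 ρ
  simp only [LinearMap.add_apply, conjBy_apply, sandwich_apply, Matrix.conjTranspose_add,
    Matrix.add_mul, Matrix.mul_add]
  abel

theorem sandwich_conjTranspose_ketbra (M N : Matrix B A ℂ) (ψ : A → ℂ) :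
    sandwich M Nᴴ (ketbra ψ) = Matrix.vecMulVec (M *ᵥ ψ) (star (N *ᵥ ψ)) := by
  rw [sandwich_apply, ketbra, Matrix.mul_vecMulVec, Matrix.vecMulVec_mul, Matrix.star_mulVec]

theorem conjBy_ketbra (M : Matrix B A ℂ) (ψ : A → ℂ) : conjBy M (ketbra ψ) = ketbra (M *ᵥ ψ) :=
  sandwich_conjTranspose_ketbra M M ψ

theorem trace_conjBy [Fintype B] (M : Matrix B A ℂ) (ρ : Matrix A A ℂ) :
    (conjBy M ρ).trace = (Mᴴ * M * ρ).trace := by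
  rw [conjBy_apply, Matrix.trace_mul_cycle]

open scoped Kronecker in
theorem ampliation_conjBy (M : Matrix B A ℂ) (E : Type*) [Fintype E] [DecidableEq E] :
    ampliation (conjBy M) E = conjBy (M ⊗ₖ (1 : Matrix E E ℂ)) := by
  ext ρ ⟨b, i⟩ ⟨b', j⟩
  have hampl : ampliation (conjBy M) E ρ (b, i) (b', j) =
      ∑ a', (∑ a, M b a * ρ (a, i) (a', j)) * star (M b' a') := rfl
  simp [hampl, conjBy_apply, Matrix.mul_apply, Fintype.sum_prod_type, Matrix.one_apply,
    apply_ite (starRingEnd ℂ)]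

theorem IsCP.conjBy [Finite B] (M : Matrix B A ℂ) : IsCP (conjBy M) := by
  cases nonempty_fintype B
  intro n ρ hρ
  rw [ampliation_conjBy]
  exact hρ.mul_mul_conjTranspose_same _

end Conjugation

end CompletelyPositive

/-! ### Iterated measurements -/

section Iteration

variable {R M N : Type*} [Semiring R] [AddCommMonoid M] [AddCommMonoid N] [Module R M] [Module R N]

theorem sum_comp_pow_add_comp_pow {E D : M →ₗ[R] N} {T : Module.End R M} (h : E + D ∘ₗ T = D)
    (n : ℕ) : ∑ i ∈ Finset.range n, E ∘ₗ T ^ i + D ∘ₗ T ^ n = D := by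
  induction n with
  | zero => rw [Finset.sum_range_zero, zero_add, pow_zero, Module.End.one_eq_id, LinearMap.comp_id]
  | succ n ih =>
    have hstep : E ∘ₗ T ^ n + D ∘ₗ T ^ (n + 1) = D ∘ₗ T ^ n := by
      rw [pow_succ', Module.End.mul_eq_comp, ← LinearMap.comp_assoc, ← LinearMap.add_comp, h]
    rw [Finset.sum_range_succ, add_assoc, hstep, ih]

end Iteration

section Instrument

variable {A B D B₀ B₁ D₀ D₁ : Type*} [Fintype A] [Fintype B] [Fintype D] [Fintype B₀] [Fintype B₁]
  [Fintype D₀] [Fintype D₁]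

theorem IsQuantumOp.comp {C' : SuperOp B D} {C : SuperOp A B} (hC' : IsQuantumOp C')
    (hC : IsQuantumOp C) : IsQuantumOp (C' ∘ₗ C) :=
  ⟨hC'.isCP.comp hC.isCP, fun ρ hρ =>
    (hC'.trace_le _ (hC.isCP.map_posSemidef hρ)).trans (hC.trace_le ρ hρ)⟩

theorem IsQuantumOp.id : IsQuantumOp (LinearMap.id : SuperOp A A) := ⟨IsCP.id, fun _ _ => le_rfl⟩

theorem trace_conjBy_of_isometry [DecidableEq A] {M : Matrix B A ℂ} (hM : Mᴴ * M = 1)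
    (ρ : Matrix A A ℂ) : (conjBy M ρ).trace = ρ.trace := by
  rw [trace_conjBy, hM, Matrix.one_mul]

theorem isQuantumOp_conjBy [DecidableEq A] {M : Matrix B A ℂ} (hM : Mᴴ * M = 1) :
    IsQuantumOp (conjBy M) :=
  ⟨IsCP.conjBy M, fun ρ _ => (congrArg Complex.re (trace_conjBy_of_isometry hM ρ)).le⟩

/-- The two completely positive branches of a binary measurement, whose output spaces may differ;
the total probability of the branches is at most one. -/
structure IsInstrument (E₀ : SuperOp A B₀) (E₁ : SuperOp A B₁) : Prop where
  isCP_left : IsCP E₀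
  isCP_right : IsCP E₁
  trace_add_le : ∀ ρ : Matrix A A ℂ, ρ.PosSemidef →
    (E₀ ρ).trace.re + (E₁ ρ).trace.re ≤ ρ.trace.re

namespace IsInstrument

theorem conjBy [DecidableEq A] {M₀ : Matrix B₀ A ℂ} {M₁ : Matrix B₁ A ℂ}
    (h : M₀ᴴ * M₀ + M₁ᴴ * M₁ = 1) : IsInstrument (conjBy M₀) (conjBy M₁) where
  isCP_left := .conjBy M₀
  isCP_right := .conjBy M₁
  trace_add_le ρ _ := by
    rw [trace_conjBy, trace_conjBy, ← Complex.add_re, ← Matrix.trace_add, ← Matrix.add_mul, h,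
      Matrix.one_mul]

theorem comp {E₀ : SuperOp A B₀} {E₁ : SuperOp A B₁} {C₀ : SuperOp B₀ D₀} {C₁ : SuperOp B₁ D₁}
    (h : IsInstrument E₀ E₁) (h₀ : IsQuantumOp C₀) (h₁ : IsQuantumOp C₁) :
    IsInstrument (C₀ ∘ₗ E₀) (C₁ ∘ₗ E₁) where
  isCP_left := h₀.isCP.comp h.isCP_left
  isCP_right := h₁.isCP.comp h.isCP_right
  trace_add_le ρ hρ :=
    (add_le_add (h₀.trace_le _ (h.isCP_left.map_posSemidef hρ))
      (h₁.trace_le _ (h.isCP_right.map_posSemidef hρ))).trans (h.trace_add_le ρ hρ)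

theorem isQuantumOp_add {E₀ E₁ : SuperOp A B} (h : IsInstrument E₀ E₁) : IsQuantumOp (E₀ + E₁) :=
  ⟨h.isCP_left.add h.isCP_right, fun ρ hρ => by
    simpa only [LinearMap.add_apply, Matrix.trace_add, Complex.add_re] using h.trace_add_le ρ hρ⟩

variable {E : SuperOp A B} {T : Module.End ℂ (Matrix A A ℂ)}

theorem sum_trace_add_trace_le (h : IsInstrument E T) {ρ : Matrix A A ℂ} (hρ : ρ.PosSemidef)
    (N : ℕ) : ∑ n ∈ Finset.range N, (E ((T ^ n) ρ)).trace.re + ((T ^ N) ρ).trace.re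
      ≤ ρ.trace.re := by
  induction N with
  | zero => simp
  | succ N ih =>
    rw [Finset.sum_range_succ, pow_succ', Module.End.mul_apply]
    linarith [h.trace_add_le _ ((h.isCP_right.pow N).map_posSemidef hρ)]

theorem sum_trace_le (h : IsInstrument E T) {ρ : Matrix A A ℂ} (hρ : ρ.PosSemidef) (N : ℕ) :
    ∑ n ∈ Finset.range N, (E ((T ^ n) ρ)).trace.re ≤ ρ.trace.re := by
  linarith [h.sum_trace_add_trace_le hρ N,
    trace_re_nonneg ((h.isCP_right.pow N).map_posSemidef hρ)]

theorem summable_comp_pow (h : IsInstrument E T) (ρ : Matrix A A ℂ) :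
    Summable fun n : ℕ => E ((T ^ n) ρ) := by
  have hρ : ρ ∈ Submodule.span ℂ {ρ : Matrix A A ℂ | ρ.PosSemidef} :=
    span_setOf_posSemidef (A := A) ▸ Submodule.mem_top
  induction hρ using Submodule.span_induction with
  | mem ρ hρ =>
    have hpos (n : ℕ) : (E ((T ^ n) ρ)).PosSemidef :=
      h.isCP_left.map_posSemidef ((h.isCP_right.pow n).map_posSemidef hρ)
    exact summable_of_posSemidef hpos
      (summable_of_sum_range_le (fun n => trace_re_nonneg (hpos n)) (h.sum_trace_le hρ))
  | zero => simpa only [map_zero] using summable_zero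
  | add ρ σ _ _ hρ hσ => simpa only [map_add] using hρ.add hσ
  | smul c ρ _ hρ => simpa only [map_smul] using hρ.const_smul c

/-- The map `ρ ↦ ∑ₙ E (Tⁿ ρ)`, which repeats a measurement as long as its outcome is `T`. -/
noncomputable def iteration (h : IsInstrument E T) : SuperOp A B where
  toFun ρ := ∑' n : ℕ, E ((T ^ n) ρ)
  map_add' ρ σ := by
    simp only [map_add]
    exact (h.summable_comp_pow ρ).tsum_add (h.summable_comp_pow σ)
  map_smul' c ρ := by
    simp only [map_smul, RingHom.id_apply]
    exact (h.summable_comp_pow ρ).tsum_const_smul c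

theorem hasSum_iteration (h : IsInstrument E T) (ρ : Matrix A A ℂ) :
    HasSum (fun n : ℕ => E ((T ^ n) ρ)) (h.iteration ρ) :=
  (h.summable_comp_pow ρ).hasSum

theorem add_iteration_comp (h : IsInstrument E T) : E + h.iteration ∘ₗ T = h.iteration := by
  ext1 ρ
  have htail := (hasSum_nat_add_iff' 1).2 (h.hasSum_iteration ρ)
  simp only [Finset.range_one, Finset.sum_singleton, pow_zero, Module.End.one_apply, pow_succ,
    Module.End.mul_apply] at htail
  rw [LinearMap.add_apply, LinearMap.comp_apply, (h.hasSum_iteration (T ρ)).unique htail,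
    add_sub_cancel]

theorem isQuantumOp_iteration (h : IsInstrument E T) : IsQuantumOp h.iteration := by
  refine ⟨IsCP.of_tendsto (C := fun N => ∑ n ∈ Finset.range N, E ∘ₗ T ^ n)
    (fun N => .sum (fun n => h.isCP_left.comp (h.isCP_right.pow n)) _) fun ρ => ?_, fun ρ hρ => ?_⟩
  · simpa only [LinearMap.sum_apply, LinearMap.comp_apply]
      using (h.hasSum_iteration ρ).tendsto_sum_nat
  · exact le_of_tendsto (hasSum_trace_re (h.hasSum_iteration ρ)).tendsto_sum_nat
      (.of_forall (h.sum_trace_le hρ))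

theorem isCP_sub_iteration (h : IsInstrument E T) {D : SuperOp A B} (hD : IsCP D)
    (hfix : E + D ∘ₗ T = D) : IsCP (D - h.iteration) := by
  -- By `N` unfoldings of `hfix`, the difference of `D` and the `N`-th partial sum is `D ∘ₗ T ^ N`.
  refine IsCP.of_tendsto (C := fun N => D ∘ₗ T ^ N)
    (fun N => hD.comp (h.isCP_right.pow N)) fun ρ => ?_
  refine ((h.hasSum_iteration ρ).tendsto_sum_nat.const_sub (D ρ)).congr fun N => ?_
  have hN := LinearMap.congr_fun (sum_comp_pow_add_comp_pow hfix N) ρ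
  rw [LinearMap.add_apply, LinearMap.sum_apply] at hN
  exact sub_eq_of_eq_add' hN.symm

end IsInstrument

end Instrument

/-! ### Vacuum extensions -/

section KrausPair

variable {A B : Type*} [Fintype A]

theorem trace_eq_add_trace_toBlocks [Fintype B] (ρ : Matrix (A ⊕ B) (A ⊕ B) ℂ) :
    ρ.trace = ρ.toBlocks₁₁.trace + ρ.toBlocks₂₂.trace :=
  Fintype.sum_sum_type _

theorem vacuumExt_conjBy (F : Matrix B A ℂ) :
    vacuumExt (conjBy F) F = conjBy (Matrix.fromBlocks F 0 0 1) := by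
  ext1 ρ
  rw [conjBy_apply, Matrix.fromBlocks_conjTranspose]
  conv_rhs => rw [← Matrix.fromBlocks_toBlocks ρ]
  simp [vacuumExt, Matrix.fromBlocks_multiply, conjBy_apply]

theorem vacuumExt_injective {p r : SuperOp A B × Matrix B A ℂ}
    (h : vacuumExt p.1 p.2 = vacuumExt r.1 r.2) : p = r := by
  classical
  have hblocks (ρ : Matrix (A ⊕ Unit) (A ⊕ Unit) ℂ) :=
    Matrix.fromBlocks_inj.1 (LinearMap.congr_fun h ρ)
  refine Prod.ext (LinearMap.ext fun ρ => ?_) (Matrix.ext fun b a => ?_)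
  · exact (hblocks (Matrix.fromBlocks ρ 0 0 0)).1
  · have hcol := (hblocks (Matrix.fromBlocks 0 (Matrix.replicateCol Unit (Pi.single a 1)) 0 0)).2.1
    simpa [Matrix.mul_apply, Pi.single_apply] using congrFun (congrFun hcol b) ()

section Inclusion

/-- The inclusion of a space into its direct sum with the vacuum. -/
def inclVac (A : Type*) [DecidableEq A] : Matrix (A ⊕ Unit) A ℂ := Matrix.fromRows 1 0

variable [Fintype B] [DecidableEq A] [DecidableEq B]

theorem conjBy_conjTranspose_inclVac (ρ : Matrix (A ⊕ Unit) (A ⊕ Unit) ℂ) :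
    conjBy (inclVac A)ᴴ ρ = ρ.toBlocks₁₁ := by
  ext i j
  simp [conjBy_apply, inclVac, Matrix.mul_apply, Matrix.one_apply, Matrix.toBlocks₁₁]

theorem conjBy_inclVac (ρ : Matrix A A ℂ) : conjBy (inclVac A) ρ = Matrix.fromBlocks ρ 0 0 0 := by
  ext i j
  rcases i with i | i <;> rcases j with j | j <;>
    simp [conjBy_apply, inclVac, Matrix.mul_apply, Matrix.one_apply]

theorem vacuumExt_sub (C C' : SuperOp A B) (F : Matrix B A ℂ) :
    vacuumExt C F - vacuumExt C' F = conjBy (inclVac B) ∘ₗ (C - C') ∘ₗ conjBy (inclVac A)ᴴ := by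
  ext1 ρ
  rw [LinearMap.comp_apply, LinearMap.comp_apply, conjBy_conjTranspose_inclVac, conjBy_inclVac,
    LinearMap.sub_apply, LinearMap.sub_apply]
  ext i j
  rcases i with i | i <;> rcases j with j | j <;> simp [vacuumExt]

end Inclusion

theorem loewnerLE_vacuumExt [Fintype B] {C C' : SuperOp A B} (F : Matrix B A ℂ)
    (h : IsCP (C' - C)) : LoewnerLE (vacuumExt C F) (vacuumExt C' F) := by
  classical
  rw [loewnerLE_iff_isCP_sub, vacuumExt_sub]
  exact (IsCP.conjBy _).comp (h.comp (IsCP.conjBy _))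

section Kraus

variable [Fintype B]

/-- The pairs `(𝒞, F)` of a quantum operation `𝒞` and one of its Kraus operators `F`, the latter
being expressed by complete positivity of `ρ ↦ 𝒞 ρ - F ρ F†`. Unlike membership in `vacuumPairs`,
which it implies, this is immediate to transport through the constructions of denotations. -/
structure IsKrausPair (p : SuperOp A B × Matrix B A ℂ) : Prop where
  isCP_sub : IsCP (p.1 - conjBy p.2)
  trace_le : ∀ ρ : Matrix A A ℂ, ρ.PosSemidef → (p.1 ρ).trace.re ≤ ρ.trace.re

theorem IsKrausPair.isQuantumOp {p : SuperOp A B × Matrix B A ℂ} (h : IsKrausPair p) :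
    IsQuantumOp p.1 :=
  ⟨sub_add_cancel p.1 (conjBy p.2) ▸ h.isCP_sub.add (IsCP.conjBy p.2), h.trace_le⟩

theorem IsKrausPair.isQuantumOp_vacuumExt {p : SuperOp A B × Matrix B A ℂ} (h : IsKrausPair p) :
    IsQuantumOp (vacuumExt p.1 p.2) := by
  classical
  refine ⟨?_, fun ρ hρ => ?_⟩
  · have hsub := vacuumExt_sub p.1 (conjBy p.2) p.2
    rw [sub_eq_iff_eq_add, vacuumExt_conjBy] at hsub
    rw [hsub]
    exact ((IsCP.conjBy _).comp (h.isCP_sub.comp (IsCP.conjBy _))).add (IsCP.conjBy _)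
  · rw [trace_eq_add_trace_toBlocks, trace_eq_add_trace_toBlocks ρ, Complex.add_re, Complex.add_re]
    exact add_le_add_left (h.trace_le _ (hρ.submatrix Sum.inl)) _

theorem isKrausPair_conjBy [DecidableEq A] {M : Matrix B A ℂ} (hM : Mᴴ * M = 1) :
    IsKrausPair (conjBy M, M) :=
  ⟨by rw [sub_self]; exact .zero, (isQuantumOp_conjBy hM).trace_le⟩

end Kraus

end KrausPair

section LeastFixedPoint

variable {X : Type u} [DecidableEq X] {Γ Δ : Finset X}

theorem IsKrausPair.mem_vacuumPairs {p : Den Γ Δ} (h : IsKrausPair p) : p ∈ vacuumPairs Γ Δ :=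
  ⟨h.isQuantumOp, h.isQuantumOp_vacuumExt⟩

theorem Den.LE.antisymm {p r : Den Γ Δ} (h : p.LE r) (h' : r.LE p) : p = r :=
  vacuumExt_injective (LoewnerLE.antisymm h h')

theorem IsLfp.lfp_eq {Φ : Den Γ Γ → Den Γ Γ} {p : Den Γ Γ} (h : IsLfp Φ p) : lfp Φ = p := by
  have hex : ∃ p, IsLfp Φ p := ⟨p, h⟩
  rw [lfp, dif_pos hex]
  have hlfp := hex.choose_spec
  exact Den.LE.antisymm (hlfp.2.2 p h.1 h.2.1) (h.2.2 _ hlfp.1 hlfp.2.1)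

end LeastFixedPoint

/-! ### Operators on one qubit -/

section OneQubit

variable {X : Type u} {q : X} {Γ : Finset X}

section Environment

variable [DecidableEq X] {Γ₁ : Finset X} (h : Ext q Γ Γ₁)

/-- Basis states of `q, Γ` as pairs of a bit for `q` and a basis state of `Γ`. -/
def Ext.splitEquiv : Basis Γ₁ ≃ Fin 2 × Basis Γ where
  toFun y := (y ⟨q, h.mem⟩, fun p => y ⟨p.1, h.subset p.2⟩)
  invFun z := fun p => if hp : p.1 ∈ Γ then z.2 ⟨p.1, hp⟩ else z.1
  left_inv y := by
    funext ⟨p, hp⟩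
    by_cases hpΓ : p ∈ Γ
    · exact dif_pos hpΓ
    · obtain rfl : p = q := by
        rw [h.eq_insert, Finset.mem_insert] at hp
        exact hp.resolve_right hpΓ
      exact dif_neg hpΓ
  right_inv z := Prod.ext (dif_neg h.notMem) (funext fun p => dif_pos p.2)

theorem ket_apply (b : Fin 2) (y : Basis Γ₁) (x : Basis Γ) :
    ket h b y x = if h.splitEquiv y = (b, x) then 1 else 0 := by
  simp only [ket, Ext.splitEquiv, Equiv.coe_fn_mk, Prod.mk.injEq, funext_iff]

theorem conjTranspose_bra (b : Fin 2) : (bra h b)ᴴ = ket h b := Matrix.conjTranspose_conjTranspose _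

theorem conjTranspose_ket (b : Fin 2) : (ket h b)ᴴ = bra h b := rfl

theorem bra_mul_ket (b c : Fin 2) : bra h b * ket h c = if b = c then 1 else 0 := by
  ext x x'
  simp only [bra, Matrix.mul_apply, Matrix.conjTranspose_apply, ket_apply]
  rw [h.splitEquiv.sum_comp fun z => star (if z = (b, x) then (1 : ℂ) else 0) *
    if z = (c, x') then 1 else 0]
  by_cases hbc : b = c <;> simp [hbc, Matrix.one_apply, eq_comm]

theorem bra_mul_ket_self (b : Fin 2) : bra h b * ket h b = 1 := by rw [bra_mul_ket, if_pos rfl]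

theorem bra_mul_ket_of_ne {b c : Fin 2} (hbc : b ≠ c) : bra h b * ket h c = 0 := by
  rw [bra_mul_ket, if_neg hbc]

theorem ket_mul_bra_add : ket h 0 * bra h 0 + ket h 1 * bra h 1 = 1 := by
  rw [← Fin.sum_univ_two fun b => ket h b * bra h b]
  ext y z
  simp only [bra, Matrix.sum_apply, Matrix.mul_apply, Matrix.conjTranspose_apply, ket_apply]
  rw [← Fintype.sum_prod_type' fun b x => (if h.splitEquiv y = (b, x) then (1 : ℂ) else 0) *
    star (if h.splitEquiv z = (b, x) then (1 : ℂ) else 0)]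
  simp [Matrix.one_apply, eq_comm]

end Environment

variable (h : q ∈ Γ)

theorem proj_add_proj : proj h 0 + proj h 1 = 1 := by
  rw [proj, proj, Matrix.diagonal_add, ← Matrix.diagonal_one]
  congr 1
  funext x
  obtain hx | hx : x ⟨q, h⟩ = 0 ∨ x ⟨q, h⟩ = 1 := by omega
  all_goals simp [hx]

variable [DecidableEq X]

theorem conjTranspose_proj_mul_proj (b : Fin 2) : (proj h b)ᴴ * proj h b = proj h b := by
  simp [proj, Matrix.diagonal_conjTranspose]

open scoped Kronecker in
theorem gateOp_eq_submatrix (U : Matrix (Fin 2) (Fin 2) ℂ) :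
    gateOp h U = (U ⊗ₖ (1 : Matrix _ _ ℂ)).submatrix (Equiv.funSplitAt ⟨q, h⟩ (Fin 2))
      (Equiv.funSplitAt ⟨q, h⟩ (Fin 2)) := by
  ext y x
  simp [gateOp, Matrix.one_apply, funext_iff]

theorem gateOp_isometry (U : Matrix.unitaryGroup (Fin 2) ℂ) :
    (gateOp h U.1)ᴴ * gateOp h U.1 = 1 := by
  rw [gateOp_eq_submatrix, Matrix.conjTranspose_submatrix, Matrix.submatrix_mul_equiv,
    Matrix.conjTranspose_kronecker, ← Matrix.mul_kronecker_mul,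
    ← Matrix.star_eq_conjTranspose U.1, Matrix.UnitaryGroup.star_mul_self,
    Matrix.conjTranspose_one, Matrix.one_mul, Matrix.one_kronecker_one,
    Matrix.submatrix_one_equiv]

end OneQubit

/-! ### Denotations of programs -/

section Denotations

variable {X : Type u} [DecidableEq X] {q : X} {Γ Γ' Γ'' : Finset X}

theorem isInstrument_proj (h : q ∈ Γ) : IsInstrument (conjBy (proj h 0)) (conjBy (proj h 1)) :=
  .conjBy (by rw [conjTranspose_proj_mul_proj, conjTranspose_proj_mul_proj, proj_add_proj])

theorem isInstrument_bra {Γ₁ : Finset X} (h : Ext q Γ Γ₁) :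
    IsInstrument (conjBy (bra h 0)) (conjBy (bra h 1)) :=
  .conjBy (by rw [conjTranspose_bra, conjTranspose_bra, ket_mul_bra_add])

theorem isQuantumOp_conjBy_ket {Γ₁ : Finset X} (h : Ext q Γ Γ₁) (b : Fin 2) :
    IsQuantumOp (conjBy (ket h b)) :=
  isQuantumOp_conjBy (bra_mul_ket_self h b)

namespace IsKrausPair

theorem comp {p : Den Γ' Γ''} {r : Den Γ Γ'} (hp : IsKrausPair p) (hr : IsKrausPair r) :
    IsKrausPair (p.comp r) := by
  refine ⟨?_, (hp.isQuantumOp.comp hr.isQuantumOp).trace_le⟩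
  have hsub : (p.comp r).1 - conjBy (p.comp r).2 =
      (p.1 - conjBy p.2) ∘ₗ r.1 + conjBy p.2 ∘ₗ (r.1 - conjBy r.2) := by
    rw [Den.comp, ← conjBy_comp, LinearMap.sub_comp, LinearMap.comp_sub, sub_add_sub_cancel]
  rw [hsub]
  exact (hp.isCP_sub.comp hr.isQuantumOp.isCP).add ((IsCP.conjBy _).comp hr.isCP_sub)

theorem meas (h : q ∈ Γ) {p₀ p₁ : Den Γ Γ'} (h₀ : IsKrausPair p₀) (h₁ : IsKrausPair p₁) :
    IsKrausPair (Den.meas h p₀ p₁) := by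
  refine ⟨?_, ((isInstrument_proj h).comp h₀.isQuantumOp h₁.isQuantumOp).isQuantumOp_add.trace_le⟩
  have hsub : (Den.meas h p₀ p₁).1 - conjBy (Den.meas h p₀ p₁).2 =
      (p₀.1 - conjBy p₀.2) ∘ₗ conjBy (proj h 0) + p₁.1 ∘ₗ conjBy (proj h 1) := by
    rw [Den.meas, ← conjBy_comp, LinearMap.sub_comp, add_sub_right_comm]
  rw [hsub]
  exact (h₀.isCP_sub.comp (IsCP.conjBy _)).add (h₁.isQuantumOp.isCP.comp (IsCP.conjBy _))

theorem discard {Γ₁ : Finset X} (h : Ext q Γ Γ₁) :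
    IsKrausPair (conjBy (bra h 0) + conjBy (bra h 1), bra h 0) :=
  ⟨by rw [add_sub_cancel_left]; exact .conjBy _, (isInstrument_bra h).isQuantumOp_add.trace_le⟩

end IsKrausPair

section QuantumCase

variable {Γ₁ Δ Δ₁ : Finset X} (hΓ : Ext q Γ Γ₁) (hΔ : Ext q Δ Δ₁)

theorem trace_sandwich_ket {b c : Fin 2} (hbc : b ≠ c) (F G : Op Γ Δ)
    (ρ : Matrix (Basis Γ₁) (Basis Γ₁) ℂ) :
    (sandwich (ket hΔ b * F * bra hΓ b) (ket hΔ c * G * bra hΓ c)ᴴ ρ).trace = 0 := by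
  have hortho : (ket hΔ c * G * bra hΓ c)ᴴ * (ket hΔ b * F * bra hΓ b) = 0 := calc
    _ = ket hΓ c * Gᴴ * (bra hΔ c * ket hΔ b) * F * bra hΓ b := by
      simp only [Matrix.conjTranspose_mul, conjTranspose_bra, conjTranspose_ket, Matrix.mul_assoc]
    _ = 0 := by
      rw [bra_mul_ket_of_ne hΔ hbc.symm, Matrix.mul_zero, Matrix.zero_mul, Matrix.zero_mul]
  rw [sandwich_apply, Matrix.trace_mul_cycle, hortho, Matrix.zero_mul, Matrix.trace_zero]

theorem IsKrausPair.qcase {p₀ p₁ : Den Γ Δ} (h₀ : IsKrausPair p₀) (h₁ : IsKrausPair p₁) :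
    IsKrausPair (Den.qcase hΓ hΔ p₀ p₁) := by
  refine ⟨?_, fun ρ hρ => ?_⟩
  · have hsub : (Den.qcase hΓ hΔ p₀ p₁).1 - conjBy (Den.qcase hΓ hΔ p₀ p₁).2 =
        conjBy (ket hΔ 0) ∘ₗ (p₀.1 - conjBy p₀.2) ∘ₗ conjBy (bra hΓ 0)
          + conjBy (ket hΔ 1) ∘ₗ (p₁.1 - conjBy p₁.2) ∘ₗ conjBy (bra hΓ 1) := by
      simp only [Den.qcase, conjBy_add, LinearMap.sub_comp, LinearMap.comp_sub, conjBy_comp,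
        ← Matrix.mul_assoc]
      abel
    rw [hsub]
    exact ((IsCP.conjBy _).comp (h₀.isCP_sub.comp (IsCP.conjBy _))).add
      ((IsCP.conjBy _).comp (h₁.isCP_sub.comp (IsCP.conjBy _)))
  · have hdiag := (isInstrument_bra hΓ).comp ((isQuantumOp_conjBy_ket hΔ 0).comp h₀.isQuantumOp)
      ((isQuantumOp_conjBy_ket hΔ 1).comp h₁.isQuantumOp)
    calc
      _ = (conjBy (ket hΔ 0) (p₀.1 (conjBy (bra hΓ 0) ρ))).trace.re
            + (conjBy (ket hΔ 1) (p₁.1 (conjBy (bra hΓ 1) ρ))).trace.re := by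
        simp only [Den.qcase, LinearMap.add_apply, LinearMap.comp_apply, Matrix.trace_add,
          Complex.add_re, trace_sandwich_ket hΓ hΔ zero_ne_one,
          trace_sandwich_ket hΓ hΔ one_ne_zero, add_zero]
      _ ≤ ρ.trace.re := hdiag.trace_add_le ρ hρ

end QuantumCase

section Loop

variable (h : q ∈ Γ) {b : Den Γ Γ}

/-- The functional whose least fixed point interprets a loop with body `b`. -/
def Den.loop (b p : Den Γ Γ) : Den Γ Γ := Den.meas h (Den.id Γ) (p.comp b)

theorem loop_eq_iff {p : Den Γ Γ} : Den.loop h b p = p ↔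
    conjBy (proj h 0) + p.1 ∘ₗ (b.1 ∘ₗ conjBy (proj h 1)) = p.1 ∧ proj h 0 = p.2 := by
  rw [Prod.ext_iff, Den.loop, Den.meas, Den.id, Den.comp, LinearMap.id_comp, Matrix.one_mul,
    LinearMap.comp_assoc]

theorem isInstrument_loop (hb : IsQuantumOp b.1) :
    IsInstrument (conjBy (proj h 0)) (b.1 ∘ₗ conjBy (proj h 1)) :=
  (isInstrument_proj h).comp .id hb

theorem isKrausPair_iteration (hb : IsQuantumOp b.1) :
    IsKrausPair ((isInstrument_loop h hb).iteration, proj h 0) := by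
  refine ⟨?_, (isInstrument_loop h hb).isQuantumOp_iteration.trace_le⟩
  rw [← (isInstrument_loop h hb).add_iteration_comp, add_sub_cancel_left]
  exact (isInstrument_loop h hb).isQuantumOp_iteration.isCP.comp (isInstrument_loop h hb).isCP_right

theorem isLfp_loop (hb : IsQuantumOp b.1) :
    IsLfp (Den.loop h b) ((isInstrument_loop h hb).iteration, proj h 0) := by
  refine ⟨(isKrausPair_iteration h hb).mem_vacuumPairs,
    (loop_eq_iff h).2 ⟨(isInstrument_loop h hb).add_iteration_comp, rfl⟩, ?_⟩
  rintro ⟨D, G⟩ hmem hfix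
  obtain ⟨hD, rfl⟩ := (loop_eq_iff h).1 hfix
  exact loewnerLE_vacuumExt _ ((isInstrument_loop h hb).isCP_sub_iteration hmem.1.isCP hD)

theorem den_whileDo {S : Stmt X} (t : Typing Γ S Γ) (hb : IsQuantumOp (den t).1) :
    den (Typing.whileDo h t) = ((isInstrument_loop h hb).iteration, proj h 0) := by
  rw [den]
  exact (isLfp_loop h hb).lfp_eq

end Loop

theorem isKrausPair_den {Δ : Finset X} {S : Stmt X} (t : Typing Γ S Δ) : IsKrausPair (den t) := by
  induction t with
  | skip =>
    rw [den, Den.id, ← conjBy_one]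
    exact isKrausPair_conjBy (by rw [Matrix.conjTranspose_one, Matrix.one_mul])
  | newQbit h => rw [den]; exact isKrausPair_conjBy (bra_mul_ket_self h 0)
  | discard h => rw [den]; exact .discard h
  | gate h => rw [den]; exact isKrausPair_conjBy (gateOp_isometry h _)
  | seq t₀ t₁ ih₀ ih₁ => rw [den]; exact ih₁.comp ih₀
  | meas h t₀ t₁ ih₀ ih₁ => rw [den]; exact .meas h ih₀ ih₁
  | whileDo h t ih =>
    rw [den_whileDo h t ih.isQuantumOp]
    exact isKrausPair_iteration h ih.isQuantumOp
  | qcase hΓ hΔ t₀ t₁ hq ih₀ ih₁ => rw [den]; exact .qcase hΓ hΔ ih₀ ih₁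

end Denotations

/-! ### Derivations of transitions -/

section Bits

@[simp]
theorem bit_true : bit true = 1 := rfl

@[simp]
theorem bit_false : bit false = 0 := rfl

theorem ketbra_bit_smul_add {A : Type*} (μ ν : Bool) (φ χ : A → ℂ) :
    ketbra (bit μ • φ + bit ν • χ) = bit μ • ketbra φ + bit ν • ketbra χ +
      bit (ν && μ) • (Matrix.vecMulVec φ (star χ) + Matrix.vecMulVec χ (star φ)) := by
  cases μ <;> cases ν <;> simp [ketbra_add, ketbra_eq_zero.2]

variable {D D' M : Type*} [AddCommMonoid M] [Module ℂ M] [TopologicalSpace M]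

theorem hasSum_bit_smul {ν : D → Bool} {d₀ : D} (h : ∀ d, ν d = true ↔ d = d₀) (f : D → M) :
    HasSum (fun d => bit (ν d) • f d) (f d₀) := by
  have hsum := hasSum_single (f := fun d => bit (ν d) • f d) d₀ fun d hd => by
    rw [Bool.eq_false_iff.2 fun hν => hd ((h d).1 hν), bit_false, zero_smul]
  simpa only [(h d₀).2 rfl, bit_true, one_smul] using hsum

theorem hasSum_prod_bit_smul {ν : D' → Bool} {d₀ : D'} (h : ∀ d, ν d = true ↔ d = d₀)
    {f : D → M} {m : M} (hf : HasSum f m) :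
    HasSum (fun z : D × D' => bit (ν z.2) • f z.1) m := by
  refine ((Prod.mk_left_injective d₀).hasSum_iff fun z hz => ?_).1 ?_
  · have hν : z.2 ≠ d₀ := fun h₀ => hz ⟨z.1, Prod.ext rfl h₀.symm⟩
    rw [Bool.eq_false_iff.2 fun h' => hν ((h _).1 h'), bit_false, zero_smul]
  · simpa only [Function.comp_def, (h d₀).2 rfl, bit_true, one_smul] using hf

end Bits

theorem hasSum_superOp {A B ι : Type*} [Finite A] (C : SuperOp A B) {f : ι → Matrix A A ℂ}
    {ρ : Matrix A A ℂ} (h : HasSum f ρ) : HasSum (fun i => C (f i)) (C ρ) :=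
  h.map C C.continuous_of_finiteDimensional

section Derivations

variable {X : Type u} [DecidableEq X] {q : X} {Γ Γ' Γ'' Γ₁ Δ Δ₁ : Finset X} {S S₀ S₁ : Stmt X}

/-- The derivations of transitions from a configuration, with their values. -/
abbrev Outcome (t : Typing Γ S Δ) (ψ : Hilb Γ) : Type u := Σ v : Hilb Δ × Bool, Exec t ψ v.1 v.2

/-- A derivation for `discard` picks one of the two rules. -/
def outcomeDiscard (h : Ext q Γ Γ₁) (ψ : Hilb Γ₁) : Outcome (.discard h) ψ ≃ Unit ⊕ Unit where
  toFun
    | ⟨(_, _), .discard₀ _ _⟩ => .inl ()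
    | ⟨(_, _), .discard₁ _ _⟩ => .inr ()
  invFun
    | .inl _ => ⟨(bra h 0 *ᵥ ψ, true), .discard₀ h ψ⟩
    | .inr _ => ⟨(bra h 1 *ᵥ ψ, false), .discard₁ h ψ⟩
  left_inv := by rintro ⟨⟨_, _⟩, ⟨⟩⟩ <;> rfl
  right_inv := by rintro (_ | _) <;> rfl

/-- A derivation for a composition runs the second statement on the value of the first one. -/
def outcomeSeq (t₀ : Typing Γ S₀ Γ') (t₁ : Typing Γ' S₁ Γ'') (ψ : Hilb Γ) :
    Outcome (.seq t₀ t₁) ψ ≃ Σ d : Outcome t₀ ψ, Outcome t₁ d.1.1 where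
  toFun
    | ⟨(χ, _), .seq (φ := φ) (ν := ν) (μ := μ) d₀ d₁⟩ => ⟨⟨(φ, ν), d₀⟩, ⟨(χ, μ), d₁⟩⟩
  invFun d := ⟨(d.2.1.1, d.1.1.2 && d.2.1.2), .seq d.1.2 d.2.2⟩
  left_inv := by rintro ⟨⟨_, _⟩, ⟨⟩⟩; rfl
  right_inv _ := rfl

/-- A derivation for a measurement runs one of the branches on the projected state. -/
def outcomeMeas (h : q ∈ Γ) (t₀ : Typing Γ S₀ Γ') (t₁ : Typing Γ S₁ Γ') (ψ : Hilb Γ) :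
    Outcome (.meas h t₀ t₁) ψ ≃ Outcome t₀ (proj h 0 *ᵥ ψ) ⊕ Outcome t₁ (proj h 1 *ᵥ ψ) where
  toFun
    | ⟨(φ, ν), .meas₀ _ d⟩ => .inl ⟨(φ, ν), d⟩
    | ⟨(φ, _), .meas₁ (ν := ν) _ d⟩ => .inr ⟨(φ, ν), d⟩
  invFun
    | .inl d => ⟨d.1, .meas₀ h d.2⟩
    | .inr d => ⟨(d.1.1, false), .meas₁ h d.2⟩
  left_inv := by rintro ⟨⟨_, _⟩, ⟨⟩⟩ <;> rfl
  right_inv := by rintro (_ | _) <;> rfl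

/-- A derivation for a quantum case runs both branches. -/
def outcomeQcase (hΓ : Ext q Γ Γ₁) (hΔ : Ext q Δ Δ₁) (t₀ : Typing Γ S₀ Δ) (t₁ : Typing Γ S₁ Δ)
    (hq : q ∉ S₀.vars ∪ S₁.vars) (ψ : Hilb Γ₁) : Outcome (.qcase hΓ hΔ t₀ t₁ hq) ψ ≃
      Outcome t₀ (bra hΓ 0 *ᵥ ψ) × Outcome t₁ (bra hΓ 1 *ᵥ ψ) where
  toFun
    | ⟨(_, _), .qcase (φ₀ := φ₀) (φ₁ := φ₁) (ν₀ := ν₀) (ν₁ := ν₁) _ _ _ d₀ d₁⟩ =>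
        (⟨(φ₀, ν₀), d₀⟩, ⟨(φ₁, ν₁), d₁⟩)
  invFun d := ⟨(bit d.2.1.2 • (ket hΔ 0 *ᵥ d.1.1.1) + bit d.1.1.2 • (ket hΔ 1 *ᵥ d.2.1.1),
    d.1.1.2 && d.2.1.2), .qcase hΓ hΔ hq d.1.2 d.2.2⟩
  left_inv := by rintro ⟨⟨_, _⟩, ⟨⟩⟩; rfl
  right_inv _ := rfl

/-- For a derivation of a loop, the number of times its body is run. The case of compositions is
there for the premise of `Exec.while₁`, a derivation for the body followed by the loop. -/
noncomputable def Exec.iterations : {Γ Δ : Finset X} → {S : Stmt X} → {t : Typing Γ S Δ} →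
    {ψ : Hilb Γ} → {φ : Hilb Δ} → {ν : Bool} → Exec t ψ φ ν → ℕ
  | _, _, _, _, _, _, _, .while₁ _ d => d.iterations + 1
  | _, _, _, _, _, _, _, .seq _ d => d.iterations
  | _, _, _, _, _, _, _, _ => 0

/-- The derivations for a loop that run its body `n` times. -/
abbrev LoopOutcome (h : q ∈ Γ) (t : Typing Γ S Γ) (n : ℕ) (ψ : Hilb Γ) : Type u :=
  {d : Outcome (.whileDo h t) ψ // d.2.iterations = n}

noncomputable instance (h : q ∈ Γ) (t : Typing Γ S Γ) (ψ : Hilb Γ) :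
    Unique (LoopOutcome h t 0 ψ) where
  default := ⟨⟨(proj h 0 *ᵥ ψ, true), .while₀ h ψ⟩, rfl⟩
  uniq := by
    rintro ⟨⟨⟨_, _⟩, d⟩, hd⟩
    cases d with
    | while₀ => rfl
    | while₁ _ d => cases d; exact absurd hd (Nat.succ_ne_zero _)

/-- A loop that runs its body `n + 1` times runs it once and is then a loop that runs it `n`
times. -/
noncomputable def loopOutcomeSucc (h : q ∈ Γ) (t : Typing Γ S Γ) (n : ℕ) (ψ : Hilb Γ) :
    LoopOutcome h t (n + 1) ψ ≃ Σ d : Outcome t (proj h 1 *ᵥ ψ), LoopOutcome h t n d.1.1 where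
  toFun
    | ⟨⟨(χ, _), .while₁ _ (.seq (φ := φ) (ν := ν) (μ := μ) d₀ d₁)⟩, hn⟩ =>
        ⟨⟨(φ, ν), d₀⟩, ⟨⟨(χ, μ), d₁⟩, Nat.succ.inj hn⟩⟩
  invFun d := ⟨⟨(d.2.1.1.1, false), .while₁ h (.seq d.1.2 d.2.1.2)⟩, congrArg Nat.succ d.2.2⟩
  left_inv := by
    rintro ⟨⟨⟨_, _⟩, d⟩, hd⟩
    cases d with
    | while₀ => exact absurd hd (Nat.succ_ne_zero _).symm
    | while₁ _ d => cases d; rfl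
  right_inv _ := rfl

end Derivations

/-! ### Adequacy -/

section Coherent

variable {X : Type u} [DecidableEq X] {q : X} {Γ Γ' Γ'' Γ₁ Δ Δ₁ : Finset X} {S S₀ S₁ : Stmt X}

/-- Exactly one derivation has bit `1`, the coherent one, and its value is `φ`. -/
def HasCoherentOutput (t : Typing Γ S Δ) (ψ : Hilb Γ) (φ : Hilb Δ) : Prop :=
  ∃ d₀ : Outcome t ψ, d₀.1.1 = φ ∧ ∀ d, d.1.2 = true ↔ d = d₀

namespace HasCoherentOutput

theorem of_forall_eq {t : Typing Γ S Δ} {ψ : Hilb Γ} {φ : Hilb Δ} {d₀ : Outcome t ψ}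
    (h : ∀ d, d = d₀) (hval : d₀.1 = (φ, true)) : HasCoherentOutput t ψ φ :=
  ⟨d₀, congrArg Prod.fst hval, fun d => ⟨fun _ => h d, fun hd => hd ▸ congrArg Prod.snd hval⟩⟩

theorem discard (h : Ext q Γ Γ₁) (ψ : Hilb Γ₁) :
    HasCoherentOutput (.discard h) ψ (bra h 0 *ᵥ ψ) := by
  refine ⟨⟨(_, true), .discard₀ h ψ⟩, rfl, ?_⟩
  rintro ⟨⟨_, _⟩, ⟨⟩⟩
  exacts [iff_of_true rfl rfl,
    iff_of_false Bool.false_ne_true fun hd => Bool.false_ne_true (congrArg (·.1.2) hd)]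

theorem seq {t₀ : Typing Γ S₀ Γ'} {t₁ : Typing Γ' S₁ Γ''} {ψ : Hilb Γ} {φ : Hilb Γ'} {χ : Hilb Γ''}
    (h₀ : HasCoherentOutput t₀ ψ φ) (h₁ : HasCoherentOutput t₁ φ χ) :
    HasCoherentOutput (.seq t₀ t₁) ψ χ := by
  obtain ⟨d₀, rfl, h₀⟩ := h₀
  obtain ⟨d₁, rfl, h₁⟩ := h₁
  refine ⟨(outcomeSeq t₀ t₁ ψ).symm ⟨d₀, d₁⟩, rfl, (outcomeSeq t₀ t₁ ψ).symm.surjective.forall.2 ?_⟩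
  rintro ⟨e₀, e₁⟩
  rw [EmbeddingLike.apply_eq_iff_eq, Sigma.mk.injEq, ← h₀]
  refine Bool.and_eq_true_iff.trans (and_congr_right fun he => ?_)
  obtain rfl := (h₀ e₀).1 he
  rw [heq_eq_eq, h₁]

theorem meas (h : q ∈ Γ) {t₀ : Typing Γ S₀ Γ'} (t₁ : Typing Γ S₁ Γ') {ψ : Hilb Γ} {φ : Hilb Γ'}
    (h₀ : HasCoherentOutput t₀ (proj h 0 *ᵥ ψ) φ) : HasCoherentOutput (.meas h t₀ t₁) ψ φ := by
  obtain ⟨d₀, rfl, h₀⟩ := h₀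
  refine ⟨(outcomeMeas h t₀ t₁ ψ).symm (.inl d₀), rfl,
    (outcomeMeas h t₀ t₁ ψ).symm.surjective.forall.2 ?_⟩
  rintro (d | d)
  · rw [EmbeddingLike.apply_eq_iff_eq, Sum.inl.injEq, ← h₀]
    rfl
  · rw [EmbeddingLike.apply_eq_iff_eq]
    exact iff_of_false Bool.false_ne_true Sum.inr_ne_inl

theorem whileDo (h : q ∈ Γ) (t : Typing Γ S Γ) (ψ : Hilb Γ) :
    HasCoherentOutput (.whileDo h t) ψ (proj h 0 *ᵥ ψ) := by
  refine ⟨⟨(_, true), .while₀ h ψ⟩, rfl, ?_⟩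
  rintro ⟨⟨_, _⟩, ⟨⟩⟩
  exacts [iff_of_true rfl rfl,
    iff_of_false Bool.false_ne_true fun hd => Bool.false_ne_true (congrArg (·.1.2) hd)]

theorem qcase (hΓ : Ext q Γ Γ₁) (hΔ : Ext q Δ Δ₁) {t₀ : Typing Γ S₀ Δ} {t₁ : Typing Γ S₁ Δ}
    (hq : q ∉ S₀.vars ∪ S₁.vars) {ψ : Hilb Γ₁} {φ₀ φ₁ : Hilb Δ}
    (h₀ : HasCoherentOutput t₀ (bra hΓ 0 *ᵥ ψ) φ₀) (h₁ : HasCoherentOutput t₁ (bra hΓ 1 *ᵥ ψ) φ₁) :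
    HasCoherentOutput (.qcase hΓ hΔ t₀ t₁ hq) ψ (ket hΔ 0 *ᵥ φ₀ + ket hΔ 1 *ᵥ φ₁) := by
  obtain ⟨d₀, rfl, h₀⟩ := h₀
  obtain ⟨d₁, rfl, h₁⟩ := h₁
  refine ⟨(outcomeQcase hΓ hΔ t₀ t₁ hq ψ).symm (d₀, d₁), ?_,
    (outcomeQcase hΓ hΔ t₀ t₁ hq ψ).symm.surjective.forall.2 ?_⟩
  · simp [outcomeQcase, (h₀ d₀).2 rfl, (h₁ d₁).2 rfl]
  · rintro ⟨e₀, e₁⟩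
    rw [EmbeddingLike.apply_eq_iff_eq, Prod.mk.injEq, ← h₀, ← h₁]
    exact Bool.and_eq_true_iff

end HasCoherentOutput

end Coherent

section Adequate

variable {X : Type u} [DecidableEq X] {q : X} {Γ Γ' Γ'' Γ₁ Δ Δ₁ : Finset X} {S S₀ S₁ : Stmt X}

/-- The pair `(𝒞, F)` describes the derivations for a program: the operator `𝒞(|ψ⟩⟨ψ|)` is the sum
over all of them, and `F|ψ⟩` is the value of the coherent one. -/
structure Adequate (t : Typing Γ S Δ) (p : Den Γ Δ) : Prop where
  hasSum : ∀ ψ, HasSum (fun d : Outcome t ψ => ketbra d.1.1) (p.1 (ketbra ψ))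
  coherent : ∀ ψ, HasCoherentOutput t ψ (p.2 *ᵥ ψ)

namespace Adequate

theorem of_forall_eq {t : Typing Γ S Δ} {M : Op Γ Δ} {d₀ : ∀ ψ, Outcome t ψ}
    (h : ∀ ψ d, d = d₀ ψ) (hval : ∀ ψ, (d₀ ψ).1 = (M *ᵥ ψ, true)) :
    Adequate t (conjBy M, M) where
  hasSum ψ := by
    have hsum := hasSum_single (f := fun d : Outcome t ψ => ketbra d.1.1) (d₀ ψ)
      fun d hd => absurd (h ψ d) hd
    rwa [hval, ← conjBy_ketbra] at hsum
  coherent ψ := .of_forall_eq (h ψ) (hval ψ)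

theorem discard (h : Ext q Γ Γ₁) :
    Adequate (.discard h) (conjBy (bra h 0) + conjBy (bra h 1), bra h 0) where
  hasSum ψ := by
    rw [← (outcomeDiscard h ψ).symm.hasSum_iff, LinearMap.add_apply, conjBy_ketbra, conjBy_ketbra]
    exact (hasSum_unique _).sum (hasSum_unique _)
  coherent := .discard h

theorem seq {t₀ : Typing Γ S₀ Γ'} {t₁ : Typing Γ' S₁ Γ''} {p₀ : Den Γ Γ'} {p₁ : Den Γ' Γ''}
    (h₀ : Adequate t₀ p₀) (h₁ : Adequate t₁ p₁) : Adequate (.seq t₀ t₁) (p₁.comp p₀) where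
  hasSum ψ := (outcomeSeq t₀ t₁ ψ).symm.hasSum_iff.1 <|
    hasSum_sigma_of_posSemidef (fun _ => posSemidef_ketbra _) (fun d => h₁.hasSum d.1.1)
      (hasSum_superOp p₁.1 (h₀.hasSum ψ))
  coherent ψ := by
    rw [Den.comp, ← Matrix.mulVec_mulVec]
    exact (h₀.coherent ψ).seq (h₁.coherent _)

theorem meas (h : q ∈ Γ) {t₀ : Typing Γ S₀ Γ'} {t₁ : Typing Γ S₁ Γ'} {p₀ p₁ : Den Γ Γ'}
    (h₀ : Adequate t₀ p₀) (h₁ : Adequate t₁ p₁) :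
    Adequate (.meas h t₀ t₁) (Den.meas h p₀ p₁) where
  hasSum ψ := by
    rw [← (outcomeMeas h t₀ t₁ ψ).symm.hasSum_iff]
    simp only [Den.meas, LinearMap.add_apply, LinearMap.comp_apply, conjBy_ketbra]
    exact (h₀.hasSum _).sum (h₁.hasSum _)
  coherent ψ := by
    rw [Den.meas, ← Matrix.mulVec_mulVec]
    exact (h₀.coherent _).meas h t₁

theorem hasSum_loopOutcome (h : q ∈ Γ) {t : Typing Γ S Γ} {p : Den Γ Γ} (ht : Adequate t p)
    (n : ℕ) (ψ : Hilb Γ) : HasSum (fun d : LoopOutcome h t n ψ => ketbra d.1.1.1)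
      (conjBy (proj h 0) (((p.1 ∘ₗ conjBy (proj h 1) : Module.End ℂ _) ^ n) (ketbra ψ))) := by
  induction n generalizing ψ with
  | zero =>
    rw [pow_zero, Module.End.one_apply, conjBy_ketbra]
    exact hasSum_unique _
  | succ n ih =>
    rw [← (loopOutcomeSucc h t n ψ).symm.hasSum_iff, pow_succ, Module.End.mul_apply,
      LinearMap.comp_apply, conjBy_ketbra]
    exact hasSum_sigma_of_posSemidef (fun _ => posSemidef_ketbra _) (fun d => ih d.1.1)
      (hasSum_superOp (conjBy (proj h 0) ∘ₗ (p.1 ∘ₗ conjBy (proj h 1) : Module.End ℂ _) ^ n)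
        (ht.hasSum _))

theorem whileDo (h : q ∈ Γ) {t : Typing Γ S Γ} {p : Den Γ Γ} (ht : Adequate t p)
    (hp : IsQuantumOp p.1) :
    Adequate (.whileDo h t) ((isInstrument_loop h hp).iteration, proj h 0) where
  hasSum ψ := (Equiv.sigmaFiberEquiv fun d : Outcome (.whileDo h t) ψ =>
      d.2.iterations).hasSum_iff.1 <|
    hasSum_sigma_of_posSemidef (fun _ => posSemidef_ketbra _)
      (fun n => ht.hasSum_loopOutcome h n ψ) ((isInstrument_loop h hp).hasSum_iteration _)
  coherent := .whileDo h t

theorem qcase (hΓ : Ext q Γ Γ₁) (hΔ : Ext q Δ Δ₁) {t₀ : Typing Γ S₀ Δ} {t₁ : Typing Γ S₁ Δ}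
    (hq : q ∉ S₀.vars ∪ S₁.vars) {p₀ p₁ : Den Γ Δ} (h₀ : Adequate t₀ p₀) (h₁ : Adequate t₁ p₁) :
    Adequate (.qcase hΓ hΔ t₀ t₁ hq) (Den.qcase hΓ hΔ p₀ p₁) where
  hasSum ψ := by
    obtain ⟨d₀, hd₀, hν₀⟩ := h₀.coherent (bra hΓ 0 *ᵥ ψ)
    obtain ⟨d₁, hd₁, hν₁⟩ := h₁.coherent (bra hΓ 1 *ᵥ ψ)
    have hdiag₀ := hasSum_prod_bit_smul hν₁
      (hasSum_superOp (conjBy (ket hΔ 0)) (h₀.hasSum (bra hΓ 0 *ᵥ ψ)))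
    have hdiag₁ := (Equiv.prodComm _ _).hasSum_iff.2
      (hasSum_prod_bit_smul hν₀ (hasSum_superOp (conjBy (ket hΔ 1)) (h₁.hasSum (bra hΓ 1 *ᵥ ψ))))
    have hcross := hasSum_bit_smul (ν := fun d : Outcome t₀ _ × Outcome t₁ _ => d.1.1.2 && d.2.1.2)
      (d₀ := (d₀, d₁)) (fun d => by rw [Bool.and_eq_true_iff, hν₀, hν₁, Prod.ext_iff])
      fun d => Matrix.vecMulVec (ket hΔ 0 *ᵥ d.1.1.1) (star (ket hΔ 1 *ᵥ d.2.1.1)) +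
        Matrix.vecMulVec (ket hΔ 1 *ᵥ d.2.1.1) (star (ket hΔ 0 *ᵥ d.1.1.1))
    rw [← (outcomeQcase hΓ hΔ t₀ t₁ hq ψ).symm.hasSum_iff]
    convert (hdiag₀.add hdiag₁).add hcross using 1
    · funext d
      simp only [Function.comp_apply, outcomeQcase, Equiv.coe_fn_symm_mk, ketbra_bit_smul_add,
        conjBy_ketbra, Equiv.prodComm_apply, Prod.fst_swap, Prod.snd_swap]
    · simp only [Den.qcase, LinearMap.add_apply, LinearMap.comp_apply, conjBy_ketbra,
        sandwich_conjTranspose_ketbra, hd₀, hd₁, Matrix.mulVec_mulVec, Matrix.mul_assoc, add_assoc]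
  coherent ψ := by
    rw [Den.qcase, Matrix.add_mulVec, ← Matrix.mulVec_mulVec, ← Matrix.mulVec_mulVec,
      ← Matrix.mulVec_mulVec, ← Matrix.mulVec_mulVec]
    exact .qcase hΓ hΔ hq (h₀.coherent _) (h₁.coherent _)

end Adequate

theorem adequate_den (t : Typing Γ S Δ) : Adequate t (den t) := by
  induction t with
  | skip =>
    rw [den, Den.id, ← conjBy_one]
    exact .of_forall_eq (d₀ := fun ψ => ⟨(_, _), .skip ψ⟩) (by rintro _ ⟨⟨_, _⟩, ⟨⟩⟩; rfl)
      fun ψ => by rw [Matrix.one_mulVec]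
  | newQbit h =>
    exact .of_forall_eq (d₀ := fun ψ => ⟨(_, _), .newQbit h ψ⟩) (by rintro _ ⟨⟨_, _⟩, ⟨⟩⟩; rfl)
      fun _ => rfl
  | discard h => exact .discard h
  | gate h =>
    exact .of_forall_eq (d₀ := fun ψ => ⟨(_, _), .gate h ψ⟩) (by rintro _ ⟨⟨_, _⟩, ⟨⟩⟩; rfl)
      fun _ => rfl
  | seq _ _ h₀ h₁ => exact h₀.seq h₁
  | meas h _ _ h₀ h₁ => exact .meas h h₀ h₁
  | whileDo h t ht =>
    have hb := (isKrausPair_den t).isQuantumOp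
    rw [den_whileDo h t hb]
    exact ht.whileDo h hb
  | qcase hΓ hΔ _ _ hq h₀ h₁ => exact .qcase hΓ hΔ hq h₀ h₁

end Adequate

/-! ### Output ensembles -/

theorem Enumerates.exists_equiv {ι κ V : Type*} {f : ι → V} {g : κ → V} {M : V → ℕ∞}
    (hf : Enumerates f M) (hg : Enumerates g M) (hM : ∀ v, M v ≠ ⊤) :
    ∃ e : ι ≃ κ, ∀ i, g (e i) = f i := by
  have he (v : V) : Nonempty ({i // f i = v} ≃ {k // g k = v}) := by
    have : Finite {i // f i = v} := by
      rw [← not_infinite_iff_finite, ← ENat.card_eq_top, hf v]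
      exact hM v
    have : Finite {k // g k = v} := by
      rw [← not_infinite_iff_finite, ← ENat.card_eq_top, hg v]
      exact hM v
    rw [← Finite.card_eq, ← Nat.cast_inj (R := ℕ∞), ← ENat.card_eq_coe_natCard,
      ← ENat.card_eq_coe_natCard, hf v, hg v]
  exact ⟨Equiv.ofFiberEquiv fun v => (he v).some, Equiv.ofFiberEquiv_map _⟩

section Ensemble

variable {X : Type u} [DecidableEq X] {Γ Δ : Finset X} {S : Stmt X} {t : Typing Γ S Δ} {ψ : Hilb Γ}

theorem outputEnsemble_of_ne {v : Hilb Δ × Bool} (hv : v ≠ (0, false)) :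
    outputEnsemble t ψ v = ENat.card {d : Outcome t ψ // d.1 = v} := by
  rw [outputEnsemble, if_neg hv]
  exact ENat.card_congr (Equiv.sigmaSubtype (β := fun v : Hilb Δ × Bool => Exec t ψ v.1 v.2) v).symm

theorem enumerates_outputEnsemble (t : Typing Γ S Δ) (ψ : Hilb Γ) :
    Enumerates (fun d : {d : Outcome t ψ // d.1 ≠ (0, false)} => d.1.1) (outputEnsemble t ψ) := by
  intro v
  by_cases hv : v = (0, false)
  · rw [outputEnsemble, if_pos hv, ENat.card_eq_zero_iff_empty]
    exact ⟨fun d => d.1.2 (d.2.trans hv)⟩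
  · rw [outputEnsemble_of_ne hv]
    exact ENat.card_congr (Equiv.subtypeSubtypeEquivSubtype
      (q := fun d : Outcome t ψ => d.1 = v) fun hd => hd.trans_ne hv)

theorem HasCoherentOutput.hasSum_bit_smul {φ : Hilb Δ} (h : HasCoherentOutput t ψ φ) :
    HasSum (fun d : Outcome t ψ => bit d.1.2 • d.1.1) φ := by
  obtain ⟨d₀, rfl, h₀⟩ := h
  exact QLang.hasSum_bit_smul h₀ fun d => d.1.1

theorem HasCoherentOutput.subsingleton {φ : Hilb Δ} (h : HasCoherentOutput t ψ φ)
    {v : Hilb Δ × Bool} (hv : v.2 = true) : Subsingleton {d : Outcome t ψ // d.1 = v} := by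
  obtain ⟨d₀, -, h₀⟩ := h
  have heq (d : {d : Outcome t ψ // d.1 = v}) : d.1 = d₀ := (h₀ _).1 (by rw [d.2, hv])
  exact ⟨fun d d' => Subtype.ext ((heq d).trans (heq d').symm)⟩

theorem Adequate.finite {p : Den Γ Δ} (h : Adequate t p) {v : Hilb Δ × Bool}
    (hv : v ≠ (0, false)) : Finite {d : Outcome t ψ // d.1 = v} := by
  obtain hv₂ | hv₂ := v.2.eq_false_or_eq_true
  · have := (h.coherent ψ).subsingleton hv₂
    infer_instance
  · by_contra hinf
    rw [not_finite_iff_infinite] at hinf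
    have hsum : Summable fun _ : {d : Outcome t ψ // d.1 = v} => ketbra v.1 :=
      ((h.hasSum ψ).summable.subtype {d | d.1 = v}).congr fun d => by rw [Function.comp_apply, d.2]
    rw [summable_const_iff, ketbra_eq_zero] at hsum
    exact hv (Prod.ext hsum hv₂)

theorem Adequate.outputEnsemble_ne_top {p : Den Γ Δ} (h : Adequate t p) (v : Hilb Δ × Bool) :
    outputEnsemble t ψ v ≠ ⊤ := by
  by_cases hv : v = (0, false)
  · rw [outputEnsemble, if_pos hv]
    exact ENat.zero_ne_top
  · rw [outputEnsemble_of_ne hv, Ne, ENat.card_eq_top, not_infinite_iff_finite]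
    exact h.finite hv

theorem Enumerates.hasSum {M : Type*} [AddCommMonoid M] [TopologicalSpace M] {ι : Type*}
    {out : ι → Hilb Δ × Bool} (hout : Enumerates out (outputEnsemble t ψ))
    (hfin : ∀ v, outputEnsemble t ψ v ≠ ⊤) {g : Hilb Δ × Bool → M} (hg : g (0, false) = 0) {s : M}
    (hs : HasSum (fun d : Outcome t ψ => g d.1) s) : HasSum (fun i => g (out i)) s := by
  obtain ⟨e, he⟩ := hout.exists_equiv (enumerates_outputEnsemble t ψ) hfin
  have hsub := (hasSum_subtype_iff_of_support_subset (s := {d : Outcome t ψ | d.1 ≠ (0, false)})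
    fun d hd h₀ => hd (by rw [h₀, hg])).2 hs
  exact (e.hasSum_iff.2 hsub).congr_fun fun i => congrArg g (he i).symm

end Ensemble

end QLang

theorem theorem3_general {X : Type*} [DecidableEq X] {Γ Δ : Finset X} {S : QLang.Stmt X}
    (t : QLang.Typing Γ S Δ) (ψ : QLang.Hilb Γ)
    (C : QLang.SuperOp (QLang.Basis Γ) (QLang.Basis Δ)) (F : QLang.Op Γ Δ)
    (hden : QLang.den t = (C, F)) :
    (∀ v, QLang.outputEnsemble t ψ v ≠ ⊤) ∧
    ∀ (ι : Type*) (out : ι → QLang.Hilb Δ × Bool),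
      QLang.Enumerates out (QLang.outputEnsemble t ψ) →
        HasSum (fun i => QLang.ketbra (out i).1) (C (QLang.ketbra ψ)) ∧
        HasSum (fun i => QLang.bit (out i).2 • (out i).1) (F *ᵥ ψ) := by
  have hadq : QLang.Adequate t (C, F) := hden ▸ QLang.adequate_den t
  refine ⟨hadq.outputEnsemble_ne_top, fun ι out hout => ⟨?_, ?_⟩⟩
  · exact hout.hasSum hadq.outputEnsemble_ne_top (g := fun v => QLang.ketbra v.1)
      (QLang.ketbra_eq_zero.2 rfl) (hadq.hasSum ψ)
  · exact hout.hasSum hadq.outputEnsemble_ne_top (g := fun v => QLang.bit v.2 • v.1)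
      (smul_zero _) (hadq.coherent ψ).hasSum_bit_smul

theorem theorem3 {X : Type*} [DecidableEq X] {Γ Δ : Finset X} {S : QLang.Stmt X}
    (t : QLang.Typing Γ S Δ) (ψ : QLang.Hilb Γ) (hψ : ψ ∈ QLang.St Γ)
    (C : QLang.SuperOp (QLang.Basis Γ) (QLang.Basis Δ)) (F : QLang.Op Γ Δ)
    (hden : QLang.den t = (C, F)) :
    (∀ v, QLang.outputEnsemble t ψ v ≠ ⊤) ∧
    ∀ (ι : Type*) (out : ι → QLang.Hilb Δ × Bool),
      QLang.Enumerates out (QLang.outputEnsemble t ψ) →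
        HasSum (fun i => QLang.ketbra (out i).1) (C (QLang.ketbra ψ)) ∧
        HasSum (fun i => QLang.bit (out i).2 • (out i).1) (F *ᵥ ψ) :=
  theorem3_general t ψ C F hden
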